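/- Let $\Bbbk$ be an algebraically closed field of characteristic $0$ and $p\ge 1$. Let ${\rm Y}={\rm Y}_p(\mathfrak{gl}_2)$ be the Yangian of level $p$: the associative $\Bbbk$-algebra with generators $t_{ij}^{(1)},\dots,t_{ij}^{(p)}$, $i,j\in\{1,2\}$, and relations $(u-v)[T_{ij}(u),T_{kl}(v)]=T_{kj}(u)T_{il}(v)-T_{kj}(v)T_{il}(u)$, where $T_{ij}(u)=\delta_{ij}u^p+\sum_{r=1}^p t_{ij}^{(r)}u^{p-r}$. Let $D(u)=T_{11}(u)T_{22}(u-1)-T_{21}(u)T_{12}(u-1)$ and let $\Gamma\subseteq{\rm Y}$ be the (commutative) subalgebra generated by the coefficients of $T_{22}(u)$ and $D(u)$. For a ${\rm Y}$-module $V$ and a maximal ideal $\mathbf m$ of $\Gamma$ put $V(\mathbf m)=\{x\in V\mid \mathbf m^n x=0 \text{ for some } n\ge 0\}$; the support ${\rm Supp}\,V$ is the set of maximal ideals $\mathbf m$ with $V(\mathbf m)\ne 0$; and $V$ is a weight module if it is finitely generated, is the direct sum of the $V(\mathbf m)$, and $\mathbf m\,V(\mathbf m)=0$ for all $\mathbf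 m$. Let $\ell=(\beta,\gamma)$ with $\beta\in\Bbbk^p$, $\gamma\in\Bbbk^{2p}$, set $\beta(u)=\prod_{i=1}^p(u+\beta_i)$, $\gamma(u)=\prod_{j=1}^{2p}(u+\gamma_j)$, and suppose that $\ell$ is generic: $\beta_i-\beta_j\notin\mathbb Z$ for $i\ne j$. Let $M(\ell)$ be the quotient of ${\rm Y}$ by the left ideal generated by the coefficients of $T_{22}(u)-\beta(u)$ and $D(u)-\gamma(u)$, and let $L(\ell)$ be the quotient of $M(\ell)$ by the sum of its proper submodules. For $x\in\mathbb Z^p$ let $\mathbf m_x$ be the ideal of $\Gamma$ generated by the coefficients of $T_{22}(u)-\prod_i(u+\beta_i+x_i)$ and $D(u)-\gamma(u)$. Then $L(\ell)$ is an irreducible weight module, the map $x\mapsto\mathbf m_x$ is injective, and there are $a_i,a_i'\in\mathbb Z\cup\{\pm\infty\}$ with $a_i\le a_i'$, $i=1,\dots,p$, such that $${\rm Supp}\,L(\ell)=\{\mathbf m_x \mid x\in\mathbb Z^p,\ a_i\le x_i\le a_i' \text{ for } i=1,\dots,p\},$$ that is, identifying $\mathbf m_x$ with $x$, the support of $L(\ell)$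 is a (possibly infinite) parallelepiped in $\mathbb Z^p$. Moreover, for every $i$, $a_i'$ is the smallest integer $m\ge 0$ with $\gamma(-\beta_i-m)=0$ if such $m$ exists, and $a_i'=+\infty$ otherwise; $a_i$ is the largest integer $n\le 0$ with $\gamma(-\beta_i-n+1)=0$ if such $n$ exists, and $a_i=-\infty$ otherwise. -/

import Mathlib

open Polynomial

namespace Yangian

noncomputable section

/-! ### The Yangian of level `p` for `gl₂` -/

/-- The element `t_{ij}^{(r)}` of the free algebra: a free generator for `1 ≤ r ≤ p`,
with `t_{ij}^{(0)} = δ_{ij}` and `t_{ij}^{(r)} = 0` for `r > p`.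
The indices `1, 2` of the matrix are `0, 1 : Fin 2`. -/
def freeT (k : Type*) [Field k] (p : ℕ) (i j : Fin 2) (r : ℕ) :
    FreeAlgebra k (Fin 2 × Fin 2 × Fin p) :=
  if r = 0 then (if i = j then 1 else 0)
  else if h : r - 1 < p then FreeAlgebra.ι k (i, j, ⟨r - 1, h⟩) else 0

/-- The defining relations
`(u - v) [T_{ij}(u), T_{kl}(v)] = T_{kj}(u) T_{il}(v) - T_{kj}(v) T_{il}(u)`,
where `T_{ij}(u) = ∑ r, t_{ij}^{(r)} u^(p - r)`:  `rel i j m l r s` is the equality of the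
coefficients of `u^(p - r) v^(p - s)` on both sides (for `r` or `s` larger than `p` both sides
are zero). -/
inductive Rel (k : Type*) [Field k] (p : ℕ) :
    FreeAlgebra k (Fin 2 × Fin 2 × Fin p) → FreeAlgebra k (Fin 2 × Fin 2 × Fin p) → Prop
  | rel (i j m l : Fin 2) (r s : ℕ) :
      Rel k p
        ((freeT k p i j (r + 1) * freeT k p m l s - freeT k p m l s * freeT k p i j (r + 1))
          - (freeT k p i j r * freeT k p m l (s + 1) - freeT k p m l (s + 1) * freeT k p i j r))
        (freeT k p m j r * freeT k p i l s - freeT k p m j s * freeT k p i l r)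

end

/-- The Yangian `Y_p(gl₂)` of level `p`. -/
abbrev Y (k : Type*) [Field k] (p : ℕ) : Type _ := RingQuot (Rel k p)

noncomputable section

/-- The element `t_{ij}^{(r)}` of `Y_p(gl₂)`. -/
def t (k : Type*) [Field k] (p : ℕ) (i j : Fin 2) (r : ℕ) : Y k p :=
  RingQuot.mkAlgHom k (Rel k p) (freeT k p i j r)

/-- `T_{ij}(u) = δ_{ij} u^p + ∑_{r=1}^p t_{ij}^{(r)} u^(p-r)`. -/
def T (k : Type*) [Field k] (p : ℕ) (i j : Fin 2) : (Y k p)[X] :=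
  ∑ r ∈ Finset.range (p + 1), C (t k p i j r) * X ^ (p - r)

/-- The quantum determinant `D(u) = T₁₁(u) T₂₂(u-1) - T₂₁(u) T₁₂(u-1)`. -/
def D (k : Type*) [Field k] (p : ℕ) : (Y k p)[X] :=
  T k p 0 0 * (T k p 1 1).comp (X - 1) - T k p 1 0 * (T k p 0 1).comp (X - 1)

/-- The subalgebra `Γ` generated by the coefficients of `T₂₂(u)` and `D(u)`.
(It is commutative, so that its left ideals below are just its ideals.) -/
def Gam (k : Type*) [Field k] (p : ℕ) : Subalgebra k (Y k p) :=
  Algebra.adjoin k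
    ({x | ∃ n : ℕ, x = (T k p 1 1).coeff n} ∪ {x | ∃ n : ℕ, x = (D k p).coeff n})

/-! ### Harish-Chandra modules, weight modules, supports -/

/-- The set `Sp Γ` of maximal ideals of `Γ`. -/
abbrev Sp (k : Type*) [Field k] (p : ℕ) : Type _ := {m : Ideal (Gam k p) // m.IsMaximal}

/-- `V(m) = {x ∈ V | m ^ n x = 0 for some n}`. -/
def genWeightSpace {k : Type*} [Field k] {p : ℕ} (V : Type*) [AddCommGroup V] [Module (Y k p) V]
    (m : Ideal (Gam k p)) : AddSubgroup V where
  carrier := {x | ∃ n : ℕ, ∀ c : Gam k p, c ∈ m ^ n → (c : Y k p) • x = 0}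
  zero_mem' := ⟨0, fun c _ => smul_zero _⟩
  add_mem' := by
    rintro x y ⟨a, ha⟩ ⟨b, hb⟩
    refine ⟨max a b, fun c hc => ?_⟩
    rw [smul_add, ha c (Ideal.pow_le_pow_right (le_max_left a b) hc),
      hb c (Ideal.pow_le_pow_right (le_max_right a b) hc), add_zero]
  neg_mem' := by
    rintro x ⟨a, ha⟩
    exact ⟨a, fun c hc => by rw [smul_neg, ha c hc, neg_zero]⟩

open Classical in
/-- Harish-Chandra modules with respect to `Γ`: finitely generated modules that are the direct sum
of the subspaces `V(m)`, where `m` runs over `Sp Γ`. -/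
def IsHarishChandra {k : Type*} [Field k] {p : ℕ} (V : Type*) [AddCommGroup V]
    [Module (Y k p) V] : Prop :=
  Module.Finite (Y k p) V ∧
    DirectSum.IsInternal (fun m : Sp k p => genWeightSpace V m.1)

/-- Weight modules: Harish-Chandra modules such that `m x = 0` for all `m` and all `x ∈ V(m)`. -/
def IsWeight {k : Type*} [Field k] {p : ℕ} (V : Type*) [AddCommGroup V]
    [Module (Y k p) V] : Prop :=
  IsHarishChandra (k := k) (p := p) V ∧
    ∀ m : Sp k p, ∀ x ∈ genWeightSpace V m.1, ∀ c ∈ m.1, (c : Y k p) • x = 0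

/-- The support `{m ∈ Sp Γ | V(m) ≠ 0}`. -/
def Supp {k : Type*} [Field k] {p : ℕ} (V : Type*) [AddCommGroup V] [Module (Y k p) V] :
    Set (Ideal (Gam k p)) :=
  {m | m.IsMaximal ∧ genWeightSpace V m ≠ ⊥}

/-! ### The modules `M(ℓ)` and `L(ℓ)`, `ℓ = (β, γ)` -/

/-- The polynomial `(u + a₁) ⋯ (u + aₙ)`. -/
def poly {k : Type*} [Field k] {n : ℕ} (a : Fin n → k) : k[X] := ∏ i, (X + C (a i))

/-- The coefficients of `T₂₂(u) - β(u)` and of `D(u) - γ(u)`. -/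
def gens {k : Type*} [Field k] {p : ℕ} (β : Fin p → k) (γ : Fin (2 * p) → k) : Set (Y k p) :=
  {x | ∃ n : ℕ, x = (T k p 1 1 - (poly β).map (algebraMap k (Y k p))).coeff n} ∪
    {x | ∃ n : ℕ, x = (D k p - (poly γ).map (algebraMap k (Y k p))).coeff n}

/-- The ideal of `Γ` that `ℓ = (β, γ)` defines: the kernel of the character of `Γ` given by
`T₂₂(u) ↦ β(u)` and `D(u) ↦ γ(u)`. -/
def specPoint {k : Type*} [Field k] {p : ℕ} (β : Fin p → k) (γ : Fin (2 * p) → k) :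
    Ideal (Gam k p) :=
  Ideal.span {c | (c : Y k p) ∈ gens β γ}

/-- The left ideal `I_ℓ` generated by the coefficients of `T₂₂(u) - β(u)` and `D(u) - γ(u)`. -/
def leftIdeal {k : Type*} [Field k] {p : ℕ} (β : Fin p → k) (γ : Fin (2 * p) → k) :
    Submodule (Y k p) (Y k p) :=
  Submodule.span (Y k p) (gens β γ)

/-- The universal module `M(ℓ) = Y_p(gl₂) / I_ℓ`. -/
abbrev M {k : Type*} [Field k] {p : ℕ} (β : Fin p → k) (γ : Fin (2 * p) → k) : Type _ :=
  Y k p ⧸ leftIdeal β γ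

/-- The sum of all proper submodules of `M(ℓ)`. -/
def maxSub {k : Type*} [Field k] {p : ℕ} (β : Fin p → k) (γ : Fin (2 * p) → k) :
    Submodule (Y k p) (M β γ) :=
  sSup {N | N ≠ ⊤}

/-- The module `L(ℓ)`, the quotient of `M(ℓ)` by the sum of its proper submodules. -/
abbrev L {k : Type*} [Field k] {p : ℕ} (β : Fin p → k) (γ : Fin (2 * p) → k) : Type _ :=
  M β γ ⧸ maxSub β γ

/-! ### Parallelepipeds -/

/-- `ℤ ∪ {±∞}`. -/
abbrev EInt : Type := WithBot (WithTop ℤ)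

/-- The inclusion of `ℤ` in `ℤ ∪ {±∞}`. -/
def toEInt (n : ℤ) : EInt := ((n : WithTop ℤ) : WithBot (WithTop ℤ))

/-- The parallelepiped `{x ∈ ℤ^p | a_i ≤ x_i ≤ a'_i for all i}`. -/
def box {p : ℕ} (a a' : Fin p → EInt) : Set (Fin p → ℤ) :=
  {x | ∀ i, a i ≤ toEInt (x i) ∧ toEInt (x i) ≤ a' i}

/-- The shift `β + k` of `β` by an integer vector. -/
def shift {k : Type*} [Field k] {p : ℕ} (β : Fin p → k) (x : Fin p → ℤ) : Fin p → k :=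
  fun i => β i + (x i : k)

end

end Yangian

set_option linter.unusedSimpArgs false
set_option linter.unusedSectionVars false

namespace Yangian

/-! ### Coefficient sequences and their generating functions at scalar points -/

section Pointwise

variable {k : Type*} [Field k]

/-! The argument is Gelfand–Tsetlin theory for `gl₂`, carried out with values of the generating
functions at scalars in place of coefficients. On a vector of weight `x`, the operator T₂₂(u) acts
by a polynomial whose roots are the p distinct numbers `node β x i`. Evaluated at the i-th root, T₂₁
raises and T₁₂ lowers the coordinate `x i` by one (`HasWeight.up`, `HasWeight.down`). An up step
followed by a down step, or conversely, is the scalar -γ at one point, because the T₁₁T₂₂ term of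
the quantum determinant vanishes there (`HasWeight.down_up`, `HasWeight.up_down`). Steps in
different directions commute.

Hence the generator of M(ℓ) yields vectors w(x), x ∈ ℤ^p, permuted by these steps up to explicit
scalars (`exists_isWeightSystem`). Off-diagonal entries have degree below p, so p nodes determine
them, while T₁₁ is recovered from the determinant; so the w(x) span M(ℓ) (`smul_mem_span`). By
genericity the weights are distinct characters of Γ, and every submodule contains the weight
components of its elements (`component_mem`).

Steps away from 0 have coefficient 1, and a step towards 0 has coefficient -γ at a point. Call x
reachable if no zero of γ blocks the way from x back to 0. A submodule containing a reachable w(x)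
contains w(0), hence everything; the unreachable w(x) span a submodule. That span is therefore the
largest proper submodule, and the support of L(ℓ) is the set of reachable x. This set is defined
coordinate by coordinate, each coordinate being bounded by the first zeros of γ on either side of 0,
so it is a parallelepiped.

It remains to see that M(ℓ) ≠ 0 (`one_notMem_leftIdeal`). For this the Yangian is represented on
functions on ℤ^p, where the delta function at 0 has the required weight. Only part of the RTT
relations and the determinant identity are checked directly (`gt_preRTT`); the rest follows wherever
T₂₂ is invertible (`PreRTT.rttAt`), which is at enough points to determine all coefficients
(`exists_algHom`). -/

theorem coeff_eq_zero_of_sum_pow_smul {V : Type*} [AddCommGroup V] [Module k V] {S : Set k}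
    (hS : S.Infinite) {N : ℕ} {g : ℕ → V}
    (h : ∀ u ∈ S, ∑ n ∈ Finset.range N, u ^ n • g n = 0) : ∀ n < N, g n = 0 := by
  intro n hn
  rw [← Module.forall_dual_apply_eq_zero_iff k]
  intro φ
  set P : k[X] := ∑ n ∈ Finset.range N, C (φ (g n)) * X ^ n with hP
  have hP0 : P = 0 := by
    refine P.eq_zero_of_infinite_isRoot (hS.mono fun u hu => ?_)
    have := congrArg φ (h u hu)
    simp only [map_sum, map_smul, map_zero, smul_eq_mul] at this
    simp only [Set.mem_ofPred_eq, IsRoot.def, hP, eval_finsetSum, eval_mul, eval_C, eval_pow, eval_X]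
    rw [← this]
    exact Finset.sum_congr rfl fun _ _ => mul_comm _ _
  have := congrArg (fun Q => Q.coeff n) hP0
  simpa [hP, finsetSum_coeff, coeff_C_mul, coeff_X_pow, hn] using this

/-- The value at `u` of `∑ r ≤ p, a r u^(p-r)`. -/
def ev {V : Type*} [AddCommGroup V] [Module k V] (p : ℕ) (a : ℕ → V) (u : k) : V :=
  ∑ r ∈ Finset.range (p + 1), u ^ (p - r) • a r

theorem eq_zero_of_ev {V : Type*} [AddCommGroup V] [Module k V] {S : Set k}
    (hS : S.Infinite) {p : ℕ} {a : ℕ → V} (h : ∀ u ∈ S, ev p a u = 0) : ∀ r ≤ p, a r = 0 := by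
  intro r hr
  have := coeff_eq_zero_of_sum_pow_smul (N := p + 1) (g := fun n => a (p - n)) hS
    (fun u hu => by
      rw [← h u hu, ev, ← Finset.sum_range_reflect]
      refine Finset.sum_congr rfl fun n hn => ?_
      rw [Finset.mem_range] at hn
      rw [show p - (p + 1 - 1 - n) = n by omega, show p + 1 - 1 - n = p - n by omega]) (p - r) (by omega)
  simpa [Nat.sub_sub_self hr] using this

/-- This turns the index shifts `r + 1`, `s + 1` of the defining relations into the factors u and v.
It is applied to commutators, which vanish at index 0 because t⁽⁰⁾ is central and at index p + 1
because t⁽ᵖ⁺¹⁾ = 0. -/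
theorem ev_succ {V : Type*} [AddCommGroup V] [Module k V] {p : ℕ} {a : ℕ → V} (h0 : a 0 = 0)
    (hp : a (p + 1) = 0) (u : k) : ev p (fun r => a (r + 1)) u = u • ev p a u := by
  rw [ev, ev, Finset.sum_range_succ, Finset.sum_range_succ', hp, h0, smul_zero, smul_zero, add_zero,
    add_zero, Finset.smul_sum]
  refine Finset.sum_congr rfl fun r hr => ?_
  rw [Finset.mem_range] at hr
  rw [smul_smul, ← pow_succ', show p - (r + 1) + 1 = p - r by omega]

theorem ev_sub {V : Type*} [AddCommGroup V] [Module k V] (p : ℕ) (a b : ℕ → V) (u : k) :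
    ev p (fun r => a r - b r) u = ev p a u - ev p b u := by
  simp [ev, smul_sub, Finset.sum_sub_distrib]

theorem map_ev {V W : Type*} [AddCommGroup V] [Module k V] [AddCommGroup W] [Module k W]
    (f : V →ₗ[k] W) (p : ℕ) (a : ℕ → V) (u : k) : f (ev p a u) = ev p (fun r => f (a r)) u := by
  simp [ev]

theorem ev_comm {V : Type*} [AddCommGroup V] [Module k V] (p : ℕ) (a : ℕ → ℕ → V) (u v : k) :
    ev p (fun r => ev p (fun s => a r s) v) u = ev p (fun s => ev p (fun r => a r s) u) v := by
  simp only [ev, Finset.smul_sum]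
  rw [Finset.sum_comm]
  exact Finset.sum_congr rfl fun _ _ => Finset.sum_congr rfl fun _ _ => smul_comm _ _ _

variable {R : Type*} [Ring R] [Algebra k R]

theorem ev_mul_right (p : ℕ) (a : ℕ → R) (u : k) (y : R) :
    ev p a u * y = ev p (fun r => a r * y) u := by
  simp [ev, Finset.sum_mul]

theorem ev_mul_left (p : ℕ) (a : ℕ → R) (u : k) (y : R) :
    y * ev p a u = ev p (fun r => y * a r) u := by
  simp [ev, Finset.mul_sum]

theorem ev_mul_ev (p : ℕ) (a b : ℕ → R) (u v : k) :
    ev p a u * ev p b v = ev p (fun r => ev p (fun s => a r * b s) v) u := by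
  rw [ev_mul_right]
  congr 1; ext r
  rw [ev_mul_left]

theorem ev_mul_ev' (p : ℕ) (a b : ℕ → R) (u v : k) :
    ev p b v * ev p a u = ev p (fun r => ev p (fun s => b s * a r) v) u := by
  rw [ev_mul_left]
  congr 1; ext r
  rw [ev_mul_right]

/-- The double generating function of the difference of the two sides of the `RTT` relations. -/
theorem ev_ev_rel {p : ℕ} {a b c d : ℕ → R} (ha0 : ∀ y, a 0 * y = y * a 0)
    (hb0 : ∀ y, b 0 * y = y * b 0) (ha : a (p + 1) = 0) (hb : b (p + 1) = 0) (u v : k) :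
    ev p (fun r => ev p (fun s => ((a (r + 1) * b s - b s * a (r + 1))
      - (a r * b (s + 1) - b (s + 1) * a r)) - (c r * d s - c s * d r)) v) u =
      (u - v) • (ev p a u * ev p b v - ev p b v * ev p a u)
        - (ev p c u * ev p d v - ev p c v * ev p d u) := by
  simp only [ev_sub]
  rw [← ev_mul_ev p c d, ev_comm p (fun r s => c s * d r), ← ev_mul_ev p c d]
  congr 1
  rw [sub_smul, ev_mul_ev p a b, ev_mul_ev' p a b]
  congr 1
  · rw [← ev_sub, ← ev_sub]
    simp only [← ev_sub]
    exact ev_succ (a := fun r => ev p (fun s => a r * b s - b s * a r) v)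
      (by simp [ev, ha0]) (by simp [ev, ha]) u
  · rw [← ev_sub, ← ev_sub]
    simp only [← ev_sub]
    have : ∀ r, ev p (fun s => a r * b (s + 1) - b (s + 1) * a r) v
        = v • ev p (fun s => a r * b s - b s * a r) v := fun r =>
      ev_succ (a := fun s => a r * b s - b s * a r) (by simp [hb0]) (by simp [hb]) v
    simp only [this]
    simp only [ev, Finset.smul_sum]
    exact Finset.sum_congr rfl fun _ _ => Finset.sum_congr rfl fun _ _ => by
      rw [smul_comm]

end Pointwise

/-! ### Deducing all RTT relations from some of them and the determinant -/

section RTT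

variable {k R : Type*} [Field k] [Ring R] [Algebra k R]

/-- The `RTT` relation for the entries `(i, j)` and `(m, l)` at the points `u` and `v`. -/
def RTTAt (F : Fin 2 → Fin 2 → k → R) (i j m l : Fin 2) (u v : k) : Prop :=
  (u - v) • (F i j u * F m l v - F m l v * F i j u) = F m j u * F i l v - F m j v * F i l u

/-- Relations between the entries of a `2 × 2` matrix from which the remaining `RTT` relations
follow wherever `T₂₂` is invertible. -/
structure PreRTT (F : Fin 2 → Fin 2 → k → R) (g : k → k) : Prop where
  dd : ∀ u v, F 1 1 u * F 1 1 v = F 1 1 v * F 1 1 u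
  cc : ∀ u v, F 1 0 u * F 1 0 v = F 1 0 v * F 1 0 u
  bb : ∀ u v, F 0 1 u * F 0 1 v = F 0 1 v * F 0 1 u
  cd : ∀ u v, RTTAt F 1 0 1 1 u v
  dc : ∀ u v, RTTAt F 1 1 1 0 u v
  bd : ∀ u v, RTTAt F 0 1 1 1 u v
  db : ∀ u v, RTTAt F 1 1 0 1 u v
  bc : ∀ u v, RTTAt F 0 1 1 0 u v
  det : ∀ u, F 1 1 (u - 1) * F 0 0 u = g u • 1 + F 1 0 (u - 1) * F 0 1 u

namespace PreRTT

variable {F : Fin 2 → Fin 2 → k → R} {g : k → k}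

/-- The relations at the shifted point u - 1 match the arguments in `det`. There the factor u - 1 -
v absorbs one term of the right-hand side and becomes u - v. -/
theorem cd_shift (h : PreRTT F g) (u v : k) :
    (u - v) • (F 1 0 (u - 1) * F 1 1 v - F 1 1 v * F 1 0 (u - 1)) =
      F 1 0 (u - 1) * F 1 1 v - F 1 1 (u - 1) * F 1 0 v := by
  have h1 := h.dc v (u - 1)
  unfold RTTAt at h1
  linear_combination (norm := (simp only [mul_sub, sub_mul, mul_add, add_mul, smul_mul_assoc,
      mul_smul_comm, mul_assoc, smul_sub, smul_add, one_mul, mul_one]; module))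
        h1

theorem dc_symm (h : PreRTT F g) (u v : k) :
    (u - v) • (F 1 1 (u - 1) * F 1 0 v - F 1 0 v * F 1 1 (u - 1)) =
      F 1 1 (u - 1) * F 1 0 v - F 1 0 (u - 1) * F 1 1 v := by
  have h1 := h.cd v (u - 1)
  unfold RTTAt at h1
  linear_combination (norm := (simp only [mul_sub, sub_mul, mul_add, add_mul, smul_mul_assoc,
      mul_smul_comm, mul_assoc, smul_sub, smul_add, one_mul, mul_one]; module))
        h1

theorem bd_shift (h : PreRTT F g) (u v : k) :
    (u - v) • (F 0 1 (u - 1) * F 1 1 v - F 1 1 v * F 0 1 (u - 1)) =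
      F 0 1 v * F 1 1 (u - 1) - F 1 1 v * F 0 1 (u - 1) := by
  have h1 := h.db v (u - 1)
  unfold RTTAt at h1
  linear_combination (norm := (simp only [mul_sub, sub_mul, mul_add, add_mul, smul_mul_assoc,
      mul_smul_comm, mul_assoc, smul_sub, smul_add, one_mul, mul_one]; module))
        h1

theorem db_shift (h : PreRTT F g) (u v : k) :
    (u - v) • (F 1 1 (u - 1) * F 0 1 v - F 0 1 v * F 1 1 (u - 1)) =
      F 1 1 v * F 0 1 (u - 1) - F 0 1 v * F 1 1 (u - 1) := by
  have h1 := h.bd v (u - 1)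
  unfold RTTAt at h1
  linear_combination (norm := (simp only [mul_sub, sub_mul, mul_add, add_mul, smul_mul_assoc,
      mul_smul_comm, mul_assoc, smul_sub, smul_add, one_mul, mul_one]; module))
        h1

theorem cd_adj (h : PreRTT F g) (u : k) :
    F 1 0 (u - 1) * F 1 1 u = F 1 1 (u - 1) * F 1 0 u := by
  have h1 := h.cd_shift u u
  rw [sub_self, zero_smul] at h1
  exact (sub_eq_zero.1 h1.symm)

theorem bd_adj (h : PreRTT F g) (u : k) :
    F 0 1 u * F 1 1 (u - 1) = F 1 1 u * F 0 1 (u - 1) := by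
  have h1 := h.bd_shift u u
  rw [sub_self, zero_smul] at h1
  exact (sub_eq_zero.1 h1.symm)

/-- After multiplication on the left by the invertible T₂₂(u - 1), `det` eliminates T₁₁(u), and only
relations assumed in `PreRTT` remain. The other relations involving T₁₁ use the same device, on the
right by means of `det_right` where that is more convenient. -/
theorem ad (h : PreRTT F g) {u : k} (hu : IsUnit (F 1 1 (u - 1))) (v : k) :
    (u - v) • (F 0 0 u * F 1 1 v - F 1 1 v * F 0 0 u) =
      F 1 0 u * F 0 1 v - F 1 0 v * F 0 1 u := by
  apply hu.mul_left_cancel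
  have h1 := h.cd_shift u v
  have h2 := h.bd u v
  unfold RTTAt at h2
  linear_combination (norm := (simp only [mul_sub, sub_mul, mul_add, add_mul, smul_mul_assoc,
      mul_smul_comm, mul_assoc, smul_sub, smul_add, one_mul, mul_one]; module))
        (u - v) • (h.det u * F 1 1 v - F 1 1 v * h.det u)
    - (u - v) • (h.dd (u - 1) v * F 0 0 u) + F 1 0 (u - 1) * h2 + h1 * F 0 1 u
    + h.cd_adj u * F 0 1 v

theorem det_right (h : PreRTT F g) {u : k} (hu : IsUnit (F 1 1 (u - 1))) :
    F 0 0 u * F 1 1 (u - 1) = g u • 1 + F 1 0 u * F 0 1 (u - 1) := by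
  have h1 := h.ad hu (u - 1)
  linear_combination (norm := (simp only [mul_sub, sub_mul, mul_add, add_mul, smul_mul_assoc,
      mul_smul_comm, mul_assoc, smul_sub, smul_add, one_mul, mul_one]; module))
        h1 + h.det u

theorem ac (h : PreRTT F g) {u : k} (hu : IsUnit (F 1 1 (u - 1))) (v : k) :
    (u - v) • (F 0 0 u * F 1 0 v - F 1 0 v * F 0 0 u) =
      F 1 0 u * F 0 0 v - F 1 0 v * F 0 0 u := by
  apply hu.mul_left_cancel
  have h1 := h.dc_symm u v
  have h2 := h.bc u v
  unfold RTTAt at h2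
  linear_combination (norm := (simp only [mul_sub, sub_mul, mul_add, add_mul, smul_mul_assoc,
      mul_smul_comm, mul_assoc, smul_sub, smul_add, one_mul, mul_one]; module))
        (u - v) • (h.det u * F 1 0 v - F 1 0 v * h.det u)
    - h1 * F 0 0 u + F 1 0 (u - 1) * h2 + (u - v) • (h.cc (u - 1) v * F 0 1 u)
    + h.cd_adj u * F 0 0 v

/-- Adding a relation to its copy with u and v interchanged gives an identity with a factor u - v,
which can be cancelled when u ≠ v. That identity exchanges the order of the products on the
right-hand side. -/
theorem da (h : PreRTT F g) {u v : k} (hv : IsUnit (F 1 1 (v - 1))) : RTTAt F 1 1 0 0 u v := by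
  rcases eq_or_ne u v with rfl | huv
  · simp [RTTAt]
  have h1 := h.ad hv u
  have h2 := h.bc u v
  have h3 := h.bc v u
  unfold RTTAt at h2 h3 ⊢
  have h4 : (u - v) • (F 0 1 u * F 1 0 v - F 0 1 v * F 1 0 u -
      (F 1 0 v * F 0 1 u - F 1 0 u * F 0 1 v)) = 0 := by
    linear_combination (norm := (simp only [mul_sub, sub_mul, mul_add, add_mul, smul_mul_assoc,
      mul_smul_comm, mul_assoc, smul_sub, smul_add, one_mul, mul_one]; module))
        h2 + h3
  have h5 := (smul_eq_zero.1 h4).resolve_left (sub_ne_zero.2 huv)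
  linear_combination (norm := (simp only [mul_sub, sub_mul, mul_add, add_mul, smul_mul_assoc,
      mul_smul_comm, mul_assoc, smul_sub, smul_add, one_mul, mul_one]; module))
        h1 - h5

theorem cb (h : PreRTT F g) {u v : k} (hu : IsUnit (F 1 1 (u - 1)))
    (hv : IsUnit (F 1 1 (v - 1))) : RTTAt F 1 0 0 1 u v := by
  rcases eq_or_ne u v with rfl | huv
  · simp [RTTAt]
  have h1 := h.ad hu v
  have h2 := h.ad hv u
  have h3 := h.bc v u
  unfold RTTAt at h3 ⊢
  have h4 : (u - v) • (F 0 0 u * F 1 1 v - F 0 0 v * F 1 1 u -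
      (F 1 1 v * F 0 0 u - F 1 1 u * F 0 0 v)) = 0 := by
    linear_combination (norm := (simp only [mul_sub, sub_mul, mul_add, add_mul, smul_mul_assoc,
      mul_smul_comm, mul_assoc, smul_sub, smul_add, one_mul, mul_one]; module))
        h1 + h2
  have h5 := (smul_eq_zero.1 h4).resolve_left (sub_ne_zero.2 huv)
  linear_combination (norm := (simp only [mul_sub, sub_mul, mul_add, add_mul, smul_mul_assoc,
      mul_smul_comm, mul_assoc, smul_sub, smul_add, one_mul, mul_one]; module))
        h3 - h5

theorem ab (h : PreRTT F g) {u v : k} (hu : IsUnit (F 1 1 (u - 1)))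
    (hv : IsUnit (F 1 1 (v - 1))) : RTTAt F 0 0 0 1 u v := by
  unfold RTTAt
  apply hu.mul_right_cancel
  have h1 := h.db_shift u v
  have h2 := h.cb hu hv
  unfold RTTAt at h2
  linear_combination (norm := (simp only [mul_sub, sub_mul, mul_add, add_mul, smul_mul_assoc,
      mul_smul_comm, mul_assoc, smul_sub, smul_add, one_mul, mul_one]; module))
        (u - v) • (h.det_right hu * F 0 1 v - F 0 1 v * h.det_right hu)
    - F 0 0 u * h1 + h2 * F 0 1 (u - 1) + (u - v) • (F 1 0 u * h.bb (u - 1) v)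
    + F 0 0 v * h.bd_adj u

theorem ba (h : PreRTT F g) {u v : k} (hu : IsUnit (F 1 1 (u - 1)))
    (hv : IsUnit (F 1 1 (v - 1))) : RTTAt F 0 1 0 0 u v := by
  rcases eq_or_ne u v with rfl | huv
  · simp [RTTAt]
  have h1 := h.ab hu hv
  have h2 := h.ab hv hu
  unfold RTTAt at h1 h2 ⊢
  have h4 : (u - v) • (F 0 0 u * F 0 1 v - F 0 1 v * F 0 0 u -
      (F 0 0 v * F 0 1 u - F 0 1 u * F 0 0 v)) = 0 := by
    linear_combination (norm := (simp only [mul_sub, sub_mul, mul_add, add_mul, smul_mul_assoc,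
      mul_smul_comm, mul_assoc, smul_sub, smul_add, one_mul, mul_one]; module))
        h1 + h2
  have h5 := (smul_eq_zero.1 h4).resolve_left (sub_ne_zero.2 huv)
  linear_combination (norm := (simp only [mul_sub, sub_mul, mul_add, add_mul, smul_mul_assoc,
      mul_smul_comm, mul_assoc, smul_sub, smul_add, one_mul, mul_one]; module))
        h2 - h5

theorem ca (h : PreRTT F g) {u v : k} (hu : IsUnit (F 1 1 (u - 1)))
    (hv : IsUnit (F 1 1 (v - 1))) : RTTAt F 1 0 0 0 u v := by
  rcases eq_or_ne u v with rfl | huv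
  · simp [RTTAt]
  have h1 := h.ac hu v
  have h2 := h.ac hv u
  unfold RTTAt
  have h4 : (u - v) • (F 0 0 u * F 1 0 v - F 1 0 v * F 0 0 u -
      (F 0 0 v * F 1 0 u - F 1 0 u * F 0 0 v)) = 0 := by
    linear_combination (norm := (simp only [mul_sub, sub_mul, mul_add, add_mul, smul_mul_assoc,
      mul_smul_comm, mul_assoc, smul_sub, smul_add, one_mul, mul_one]; module))
        h1 + h2
  have h5 := (smul_eq_zero.1 h4).resolve_left (sub_ne_zero.2 huv)
  linear_combination (norm := (simp only [mul_sub, sub_mul, mul_add, add_mul, smul_mul_assoc,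
      mul_smul_comm, mul_assoc, smul_sub, smul_add, one_mul, mul_one]; module))
        h2 - h5

theorem aa_smul (h : PreRTT F g) {u v : k} (hu : IsUnit (F 1 1 (u - 1)))
    (hu' : IsUnit (F 1 1 (u - 1 - 1))) (hv : IsUnit (F 1 1 (v - 1))) :
    (u - v - 1) • (F 0 0 u * F 0 0 v - F 0 0 v * F 0 0 u) = 0 := by
  apply hu.mul_right_cancel
  rw [zero_mul]
  have h1 := h.ca hu hv
  have h2 := h.ab hv hu'
  have h3 := h.ad hv (u - 1)
  have h4 := h.ca hu hu'
  unfold RTTAt at h1 h2 h4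
  have h5 : F 1 0 u * F 0 0 (u - 1) = F 0 0 u * F 1 0 (u - 1) := by
    linear_combination (norm := (simp only [mul_sub, sub_mul, mul_add, add_mul, smul_mul_assoc,
      mul_smul_comm, mul_assoc, smul_sub, smul_add, one_mul, mul_one]; module))
        h4
  linear_combination (norm := (simp only [mul_sub, sub_mul, mul_add, add_mul, smul_mul_assoc,
      mul_smul_comm, mul_assoc, smul_sub, smul_add, one_mul, mul_one]; module))
        (u - v) • (h.det_right hu * F 0 0 v - F 0 0 v * h.det_right hu)
    - F 0 0 u * h3 + F 1 0 u * h2 + h1 * F 0 1 (u - 1) - h.det_right hu * F 0 0 v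
    + F 0 0 v * h.det_right hu - h5 * F 0 1 v

/-- By `aa_smul` the commutator is killed by u - v - 1 and, after exchanging u and v, by u - v + 1.
The difference of these scalars is 2. -/
theorem aa [CharZero k] (h : PreRTT F g) {u v : k} (hu : IsUnit (F 1 1 (u - 1)))
    (hu' : IsUnit (F 1 1 (u - 1 - 1))) (hv : IsUnit (F 1 1 (v - 1)))
    (hv' : IsUnit (F 1 1 (v - 1 - 1))) : F 0 0 u * F 0 0 v = F 0 0 v * F 0 0 u := by
  have h1 := h.aa_smul hu hu' hv
  have h2 := h.aa_smul hv hv' hu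
  have h3 : (2 : k) • (F 0 0 u * F 0 0 v - F 0 0 v * F 0 0 u) = 0 := by
    linear_combination (norm := (simp only [mul_sub, sub_mul, mul_add, add_mul, smul_mul_assoc,
      mul_smul_comm, mul_assoc, smul_sub, smul_add, one_mul, mul_one]; module))
        h2 - h1
  exact sub_eq_zero.1 ((smul_eq_zero.1 h3).resolve_left two_ne_zero)

/-- All the `RTT` relations hold where `T₂₂` is invertible. -/
theorem rttAt [CharZero k] (h : PreRTT F g) {u v : k} (hu : IsUnit (F 1 1 (u - 1)))
    (hu' : IsUnit (F 1 1 (u - 1 - 1))) (hv : IsUnit (F 1 1 (v - 1)))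
    (hv' : IsUnit (F 1 1 (v - 1 - 1))) (i j m l : Fin 2) : RTTAt F i j m l u v := by
  have comm : ∀ i j, (∀ u v, F i j u * F i j v = F i j v * F i j u) → ∀ u v, RTTAt F i j i j u v :=
    fun i j hc u v => by
      unfold RTTAt
      rw [hc u v, sub_self, smul_zero]
  fin_cases i <;> fin_cases j <;> fin_cases m <;> fin_cases l
  · simp only [RTTAt]
    change (u - v) • (F 0 0 u * F 0 0 v - F 0 0 v * F 0 0 u) =
      F 0 0 u * F 0 0 v - F 0 0 v * F 0 0 u
    rw [h.aa hu hu' hv hv', sub_self, smul_zero]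
  · exact h.ab hu hv
  · exact h.ac hu v
  · exact h.ad hu v
  · exact h.ba hu hv
  · exact comm _ _ h.bb u v
  · exact h.bc u v
  · exact h.bd u v
  · exact h.ca hu hv
  · exact h.cb hu hv
  · exact comm _ _ h.cc u v
  · exact h.cd u v
  · exact h.da hv
  · exact h.db u v
  · exact h.dc u v
  · exact comm _ _ h.dd u v

end PreRTT

end RTT

/-! ### Interpolated shift operators on functions on ℤ^p -/

section GelfandTsetlin

variable {k : Type*} [Field k] {p : ℕ}

/-- The roots of `∏ i, (u + β i + x i)`. -/
def node (β : Fin p → k) (x : Fin p → ℤ) (i : Fin p) : k := -(β i + x i)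

theorem node_single_self (β : Fin p → k) (x : Fin p → ℤ) (i : Fin p) (s : ℤ) :
    node β (x + Pi.single i s) i = node β x i - s := by
  simp [node]; ring

theorem node_single_of_ne (β : Fin p → k) (x : Fin p → ℤ) {i j : Fin p} (h : j ≠ i) (s : ℤ) :
    node β (x + Pi.single i s) j = node β x j := by
  simp [node, h]

theorem node_injective {β : Fin p → k} (hβ : ∀ i j, i ≠ j → ∀ n : ℤ, β i - β j ≠ (n : k))
    (x : Fin p → ℤ) : Function.Injective (node β x) := by
  intro i j h
  by_contra hij
  refine hβ i j hij (x j - x i) ?_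
  simp only [node, neg_inj] at h
  push_cast
  linear_combination h

theorem eval_poly_shift (β : Fin p → k) (x : Fin p → ℤ) (u : k) :
    (poly (shift β x)).eval u = ∏ i, (u - node β x i) := by
  simp only [poly, eval_prod, shift, node, eval_add, eval_X, eval_C, sub_neg_eq_add]

theorem poly_monic {n : ℕ} (a : Fin n → k) : (poly a).Monic :=
  monic_prod_of_monic _ _ fun i _ => monic_X_add_C (a i)

theorem poly_natDegree {n : ℕ} (a : Fin n → k) : (poly a).natDegree = n := by
  rw [poly, natDegree_prod_of_monic _ _ fun i _ => monic_X_add_C (a i)]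
  simp

/-- The Lagrange basis at the nodes `node β x`. -/
noncomputable def lag (β : Fin p → k) (x : Fin p → ℤ) (i : Fin p) : k[X] :=
  Lagrange.basis Finset.univ (node β x) i

/-- The roots other than the i-th do not see a move in direction i. So the i-th Lagrange polynomial
and the eigenvalues before and after the move share the factor Q, and commutation of a step with T₂₂
becomes an identity between linear factors. -/
theorem exists_factor (β : Fin p → k) (x : Fin p → ℤ) (i : Fin p) :
    ∃ Q : k[X], Q.Monic ∧ Q.natDegree = p - 1 ∧
      lag β x i = C (Lagrange.nodalWeight Finset.univ (node β x) i) * Q ∧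
      ∀ s : ℤ, ∀ u, (poly (shift β (x + Pi.single i s))).eval u =
        (u - node β x i + s) * Q.eval u := by
  refine ⟨∏ j ∈ Finset.univ.erase i, (X - C (node β x j)), ?_, ?_, ?_, ?_⟩
  · exact monic_prod_of_monic _ _ fun j _ => monic_X_sub_C _
  · rw [natDegree_prod_of_monic _ _ fun j _ => monic_X_sub_C _]
    simp
  · rw [lag, Lagrange.basis, Lagrange.nodalWeight, map_prod, ← Finset.prod_mul_distrib]
    rfl
  · intro s u
    rw [eval_poly_shift, ← Finset.mul_prod_erase _ _ (Finset.mem_univ i), node_single_self,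
      eval_prod]
    congr 1
    · ring
    · refine Finset.prod_congr rfl fun j hj => ?_
      rw [node_single_of_ne _ _ (Finset.ne_of_mem_erase hj)]
      simp

theorem exists_factor_zero (β : Fin p → k) (x : Fin p → ℤ) (i : Fin p) :
    ∃ Q : k[X], Q.Monic ∧ Q.natDegree = p - 1 ∧
      lag β x i = C (Lagrange.nodalWeight Finset.univ (node β x) i) * Q ∧
      (∀ u, (poly (shift β x)).eval u = (u - node β x i) * Q.eval u) ∧
      ∀ s : ℤ, ∀ u, (poly (shift β (x + Pi.single i s))).eval u =
        (u - node β x i + s) * Q.eval u := by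
  obtain ⟨Q, h1, h2, h3, h4⟩ := exists_factor β x i
  exact ⟨Q, h1, h2, h3, fun u => by simpa using h4 0 u, h4⟩

theorem eval_lag_self {β : Fin p → k} {x : Fin p → ℤ} (hx : Function.Injective (node β x))
    (i : Fin p) : (lag β x i).eval (node β x i) = 1 :=
  Lagrange.eval_basis_self hx.injOn (Finset.mem_univ i)

theorem eval_lag_of_ne (β : Fin p → k) (x : Fin p → ℤ) {i j : Fin p} (h : i ≠ j) :
    (lag β x i).eval (node β x j) = 0 :=
  Lagrange.eval_basis_of_ne h (Finset.mem_univ j)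

theorem eval_eq_sum_lag {β : Fin p → k} {x : Fin p → ℤ} (hx : Function.Injective (node β x))
    {q : k[X]} (hq : q.degree < p) (u : k) :
    q.eval u = ∑ j, (lag β x j).eval u * q.eval (node β x j) := by
  conv_lhs => rw [Lagrange.eq_interpolate (f := q) (s := Finset.univ) hx.injOn (by simpa using hq)]
  simp [Lagrange.interpolate_apply, eval_finsetSum, lag, mul_comm]

/-- The endomorphisms `r ↦` (coefficient of `u^(p-r)`) of an operator valued polynomial. -/
noncomputable def opSeq {ι : Type*} (p : ℕ) (Φ : (ι → k) →ₗ[k] (ι → k[X])) (r : ℕ) :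
    Module.End k (ι → k) :=
  if r ≤ p then LinearMap.pi fun x => lcoeff k (p - r) ∘ₗ LinearMap.proj x ∘ₗ Φ else 0

theorem opSeq_of_le {ι : Type*} {Φ : (ι → k) →ₗ[k] (ι → k[X])} {r : ℕ} (h : r ≤ p) (f : ι → k)
    (x : ι) : opSeq p Φ r f x = (Φ f x).coeff (p - r) := by
  simp [opSeq, h]

theorem opSeq_of_lt {ι : Type*} {Φ : (ι → k) →ₗ[k] (ι → k[X])} {r : ℕ} (h : p < r) :
    opSeq p Φ r = 0 := by
  simp [opSeq, h]

theorem ev_coeff {q : k[X]} (h : q.natDegree ≤ p) (u : k) :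
    ev p (fun r => q.coeff (p - r)) u = q.eval u := by
  rw [eval_eq_sum_range' (Nat.lt_succ_of_le h), ev, ← Finset.sum_range_reflect]
  refine Finset.sum_congr rfl fun r hr => ?_
  rw [Finset.mem_range] at hr
  rw [show p - (p + 1 - 1 - r) = r by omega, smul_eq_mul, mul_comm]

theorem ev_apply {ι : Type*} (a : ℕ → Module.End k (ι → k)) (u : k) (f : ι → k) (x : ι) :
    ev p a u f x = ev p (fun r => a r f x) u := by
  simp [ev, LinearMap.sum_apply, Finset.sum_apply]

theorem ev_congr {V : Type*} [AddCommGroup V] [Module k V] {a b : ℕ → V}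
    (h : ∀ r ≤ p, a r = b r) (u : k) : ev p a u = ev p b u :=
  Finset.sum_congr rfl fun r hr => by
    rw [h r (Nat.lt_succ_iff.1 (Finset.mem_range.1 hr))]

theorem ev_opSeq {ι : Type*} {Φ : (ι → k) →ₗ[k] (ι → k[X])} {f : ι → k} {x : ι}
    (h : (Φ f x).natDegree ≤ p) (u : k) : ev p (opSeq p Φ) u f x = (Φ f x).eval u := by
  rw [ev_apply, ← ev_coeff h]
  exact ev_congr (fun r hr => opSeq_of_le hr f x) u

/-- The operator valued polynomial that takes at the node `node β x i` the value
`f ↦ w x i * f (x + s eᵢ)`. -/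
noncomputable def stepPoly (β : Fin p → k) (w : (Fin p → ℤ) → Fin p → k) (s : ℤ) :
    ((Fin p → ℤ) → k) →ₗ[k] ((Fin p → ℤ) → k[X]) :=
  LinearMap.pi fun x => Lagrange.interpolate Finset.univ (node β x) ∘ₗ
    LinearMap.pi fun i => w x i • LinearMap.proj (x + Pi.single i s)

theorem stepPoly_apply (β : Fin p → k) (w : (Fin p → ℤ) → Fin p → k) (s : ℤ)
    (f : (Fin p → ℤ) → k) (x : Fin p → ℤ) :
    stepPoly β w s f x = ∑ i, C (w x i * f (x + Pi.single i s)) * lag β x i := by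
  simp [stepPoly, Lagrange.interpolate_apply, lag]

theorem degree_stepPoly_lt {β : Fin p → k} (hβ : ∀ x, Function.Injective (node β x))
    (w : (Fin p → ℤ) → Fin p → k) (s : ℤ) (f : (Fin p → ℤ) → k) (x : Fin p → ℤ) :
    (stepPoly β w s f x).degree < p := by
  have h := Lagrange.degree_interpolate_lt (s := Finset.univ)
    (fun i => w x i * f (x + Pi.single i s)) (hβ x).injOn
  rw [Finset.card_univ, Fintype.card_fin] at h
  rw [stepPoly_apply]
  simpa only [Lagrange.interpolate_apply, lag] using h

/-- The coefficients of `stepPoly`. -/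
noncomputable def stepSeq (β : Fin p → k) (w : (Fin p → ℤ) → Fin p → k) (s : ℤ) :
    ℕ → Module.End k ((Fin p → ℤ) → k) := opSeq p (stepPoly β w s)

section Step

variable {β : Fin p → k}

theorem ev_stepSeq (hβ : ∀ x, Function.Injective (node β x)) (w : (Fin p → ℤ) → Fin p → k) (s : ℤ)
    (u : k) (f : (Fin p → ℤ) → k) (x : Fin p → ℤ) :
    ev p (stepSeq β w s) u f x = (stepPoly β w s f x).eval u :=
  ev_opSeq (natDegree_le_of_degree_le (degree_stepPoly_lt hβ w s f x).le) u

theorem ev_stepSeq_apply (hβ : ∀ x, Function.Injective (node β x)) (w : (Fin p → ℤ) → Fin p → k)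
    (s : ℤ) (u : k) (f : (Fin p → ℤ) → k) (x : Fin p → ℤ) :
    ev p (stepSeq β w s) u f x
      = ∑ i, (lag β x i).eval u * (w x i * f (x + Pi.single i s)) := by
  rw [ev_stepSeq hβ, stepPoly_apply, eval_finsetSum]
  exact Finset.sum_congr rfl fun i _ => by rw [eval_mul, eval_C, mul_comm]

theorem ev_stepSeq_node (hβ : ∀ x, Function.Injective (node β x)) (w : (Fin p → ℤ) → Fin p → k)
    (s : ℤ) (f : (Fin p → ℤ) → k) (x : Fin p → ℤ) (i : Fin p) :
    ev p (stepSeq β w s) (node β x i) f x = w x i * f (x + Pi.single i s) := by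
  rw [ev_stepSeq_apply hβ, Finset.sum_eq_single i]
  · rw [eval_lag_self (hβ x), one_mul]
  · intro j _ hj
    rw [eval_lag_of_ne _ _ hj, zero_mul]
  · simp

theorem ev_stepSeq_interp (hβ : ∀ x, Function.Injective (node β x))
    (w : (Fin p → ℤ) → Fin p → k) (s : ℤ)
    (u : k) (f : (Fin p → ℤ) → k) (x y : Fin p → ℤ) :
    ev p (stepSeq β w s) u f y
      = ∑ j, (lag β x j).eval u * ev p (stepSeq β w s) (node β x j) f y := by
  simp only [ev_stepSeq hβ]
  exact eval_eq_sum_lag (hβ x) (degree_stepPoly_lt hβ w s f y) u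

theorem ev_stepSeq_mul (hβ : ∀ x, Function.Injective (node β x))
    (w w' : (Fin p → ℤ) → Fin p → k) (s s' : ℤ)
    (u v : k) (f : (Fin p → ℤ) → k) (x : Fin p → ℤ) :
    (ev p (stepSeq β w s) u * ev p (stepSeq β w' s') v) f x
      = ∑ i, ∑ j, (lag β x i).eval u * (lag β x j).eval v *
        (w x i * ev p (stepSeq β w' s') (node β x j) f (x + Pi.single i s)) := by
  rw [Module.End.mul_apply, ev_stepSeq_apply hβ]
  refine Finset.sum_congr rfl fun i _ => ?_
  rw [ev_stepSeq_interp hβ w' s' v f x, Finset.mul_sum, Finset.mul_sum]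
  exact Finset.sum_congr rfl fun j _ => by ring

theorem ev_stepSeq_shift (hβ : ∀ x, Function.Injective (node β x))
    (w : (Fin p → ℤ) → Fin p → k) (s s' : ℤ)
    (f : (Fin p → ℤ) → k) (x : Fin p → ℤ) {i j : Fin p} (hij : j ≠ i) :
    ev p (stepSeq β w s) (node β x j) f (x + Pi.single i s') =
      w (x + Pi.single i s') j * f (x + Pi.single i s' + Pi.single j s) := by
  rw [← node_single_of_ne β x hij s', ev_stepSeq_node hβ]

theorem ev_stepSeq_comm (hβ : ∀ x, Function.Injective (node β x))
    {w : (Fin p → ℤ) → Fin p → k} {s : ℤ}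
    (hw : ∀ x i j, j ≠ i → w (x + Pi.single i s) j = w x j) (u v : k) :
    ev p (stepSeq β w s) u * ev p (stepSeq β w s) v =
      ev p (stepSeq β w s) v * ev p (stepSeq β w s) u := by
  ext f x
  rw [ev_stepSeq_mul hβ, ev_stepSeq_mul hβ, Finset.sum_comm]
  refine Finset.sum_congr rfl fun j _ => Finset.sum_congr rfl fun i _ => ?_
  rcases eq_or_ne j i with rfl | hij
  · ring
  · rw [ev_stepSeq_shift hβ w s s f x hij, ev_stepSeq_shift hβ w s s f x hij.symm, hw _ _ _ hij,
      hw _ _ _ hij.symm, add_right_comm]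
    ring

end Step

/-- The coefficients of the diagonal operator `f ↦ (∏ i, (u + β i + x i)) f(x)`. -/
noncomputable def diagSeq (β : Fin p → k) : ℕ → Module.End k ((Fin p → ℤ) → k) :=
  opSeq p (LinearMap.pi fun x =>
    LinearMap.toSpanSingleton k k[X] (poly (shift β x)) ∘ₗ LinearMap.proj x)

theorem diagSeq_apply (β : Fin p → k) {r : ℕ} (hr : r ≤ p) (f : (Fin p → ℤ) → k)
    (x : Fin p → ℤ) : diagSeq β r f x = f x * (poly (shift β x)).coeff (p - r) := by
  simp [diagSeq, opSeq_of_le hr]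

theorem ev_diagSeq (β : Fin p → k) (u : k) (f : (Fin p → ℤ) → k) (x : Fin p → ℤ) :
    ev p (diagSeq β) u f x = (poly (shift β x)).eval u * f x := by
  rw [diagSeq, ev_opSeq]
  · simp [mul_comm]
  · simpa using (natDegree_smul_le _ _).trans (poly_natDegree _).le

theorem step_diag (hβ : ∀ x, Function.Injective (node (p := p) (k := k) β x))
    (w : (Fin p → ℤ) → Fin p → k) (s : ℤ) (u v : k) (f : (Fin p → ℤ) → k) (x : Fin p → ℤ) :
    (ev p (stepSeq β w s) u * ev p (diagSeq β) v) f x = ∑ i, (lag β x i).eval u *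
      (w x i * ((poly (shift β (x + Pi.single i s))).eval v * f (x + Pi.single i s))) := by
  rw [Module.End.mul_apply, ev_stepSeq_apply hβ]
  simp only [ev_diagSeq]

theorem diag_step (hβ : ∀ x, Function.Injective (node (p := p) (k := k) β x))
    (w : (Fin p → ℤ) → Fin p → k) (s : ℤ) (u v : k) (f : (Fin p → ℤ) → k) (x : Fin p → ℤ) :
    (ev p (diagSeq β) v * ev p (stepSeq β w s) u) f x = ∑ i, (lag β x i).eval u *
      (w x i * ((poly (shift β x)).eval v * f (x + Pi.single i s))) := by
  rw [Module.End.mul_apply, ev_diagSeq, ev_stepSeq_apply hβ, Finset.mul_sum]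
  exact Finset.sum_congr rfl fun _ _ => by ring

/-- The identity holds for each direction i separately. Once the common factor Q of `exists_factor`
is extracted, it is a scalar identity; the three relations below are proved likewise. -/
theorem down_diag {β : Fin p → k} (hβ : ∀ x, Function.Injective (node β x))
    (w : (Fin p → ℤ) → Fin p → k) (u v : k) :
    (u - v) • (ev p (stepSeq β w (-1)) u * ev p (diagSeq β) v
      - ev p (diagSeq β) v * ev p (stepSeq β w (-1)) u) =
    ev p (stepSeq β w (-1)) u * ev p (diagSeq β) v
      - ev p (stepSeq β w (-1)) v * ev p (diagSeq β) u := by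
  ext f x
  simp only [LinearMap.smul_apply, LinearMap.sub_apply, Pi.smul_apply, Pi.sub_apply, smul_eq_mul]
  simp only [step_diag hβ, diag_step hβ]
  simp only [← Finset.sum_sub_distrib, Finset.mul_sum]
  refine Finset.sum_congr rfl fun i _ => ?_
  obtain ⟨Q, -, -, h1, h2, h3⟩ := exists_factor_zero β x i
  simp only [h1, h2, h3, eval_mul, eval_C]
  push_cast
  ring

theorem diag_down {β : Fin p → k} (hβ : ∀ x, Function.Injective (node β x))
    (w : (Fin p → ℤ) → Fin p → k) (u v : k) :
    (u - v) • (ev p (diagSeq β) u * ev p (stepSeq β w (-1)) v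
      - ev p (stepSeq β w (-1)) v * ev p (diagSeq β) u) =
    ev p (diagSeq β) u * ev p (stepSeq β w (-1)) v
      - ev p (diagSeq β) v * ev p (stepSeq β w (-1)) u := by
  ext f x
  simp only [LinearMap.smul_apply, LinearMap.sub_apply, Pi.smul_apply, Pi.sub_apply, smul_eq_mul]
  simp only [step_diag hβ, diag_step hβ]
  simp only [← Finset.sum_sub_distrib, Finset.mul_sum]
  refine Finset.sum_congr rfl fun i _ => ?_
  obtain ⟨Q, -, -, h1, h2, h3⟩ := exists_factor_zero β x i
  simp only [h1, h2, h3, eval_mul, eval_C]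
  push_cast
  ring

theorem up_diag {β : Fin p → k} (hβ : ∀ x, Function.Injective (node β x))
    (w : (Fin p → ℤ) → Fin p → k) (u v : k) :
    (u - v) • (ev p (stepSeq β w 1) u * ev p (diagSeq β) v
      - ev p (diagSeq β) v * ev p (stepSeq β w 1) u) =
    ev p (diagSeq β) u * ev p (stepSeq β w 1) v
      - ev p (diagSeq β) v * ev p (stepSeq β w 1) u := by
  ext f x
  simp only [LinearMap.smul_apply, LinearMap.sub_apply, Pi.smul_apply, Pi.sub_apply, smul_eq_mul]
  simp only [step_diag hβ, diag_step hβ]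
  simp only [← Finset.sum_sub_distrib, Finset.mul_sum]
  refine Finset.sum_congr rfl fun i _ => ?_
  obtain ⟨Q, -, -, h1, h2, h3⟩ := exists_factor_zero β x i
  simp only [h1, h2, h3, eval_mul, eval_C]
  push_cast
  ring

theorem diag_up {β : Fin p → k} (hβ : ∀ x, Function.Injective (node β x))
    (w : (Fin p → ℤ) → Fin p → k) (u v : k) :
    (u - v) • (ev p (diagSeq β) u * ev p (stepSeq β w 1) v
      - ev p (stepSeq β w 1) v * ev p (diagSeq β) u) =
    ev p (stepSeq β w 1) u * ev p (diagSeq β) v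
      - ev p (stepSeq β w 1) v * ev p (diagSeq β) u := by
  ext f x
  simp only [LinearMap.smul_apply, LinearMap.sub_apply, Pi.smul_apply, Pi.sub_apply, smul_eq_mul]
  simp only [step_diag hβ, diag_step hβ]
  simp only [← Finset.sum_sub_distrib, Finset.mul_sum]
  refine Finset.sum_congr rfl fun i _ => ?_
  obtain ⟨Q, -, -, h1, h2, h3⟩ := exists_factor_zero β x i
  simp only [h1, h2, h3, eval_mul, eval_C]
  push_cast
  ring

theorem diag_diag (β : Fin p → k) (u v : k) :
    ev p (diagSeq β) u * ev p (diagSeq β) v = ev p (diagSeq β) v * ev p (diagSeq β) u := by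
  ext f x
  simp only [Module.End.mul_apply, ev_diagSeq]
  ring

end GelfandTsetlin

/-! ### The Gelfand–Tsetlin representation and its determinant -/

section GelfandTsetlinModule

variable {k : Type*} [Field k] {p : ℕ}

theorem ev_sub_mul {R : Type*} [Ring R] [Algebra k R] (a b : ℕ → R) (y : R) (u : k) :
    ev p (fun r => a r - (b r * y - y * b r)) u
      = ev p a u - (ev p b u * y - y * ev p b u) := by
  rw [ev_sub p a, ev_sub p (fun r => b r * y), ev_mul_right, ev_mul_left]

/-- The weights of the operator `T₁₂`. -/
noncomputable def upWeight (β : Fin p → k) (γ : Fin (2 * p) → k) (x : Fin p → ℤ) (i : Fin p) : k :=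
  -(poly γ).eval (node β x i)

/-- The generators of the Yangian in its Gelfand–Tsetlin representation on functions on `ℤ^p`. -/
noncomputable def gtSeq (β : Fin p → k) (γ : Fin (2 * p) → k) (i j : Fin 2) (r : ℕ) :
    Module.End k ((Fin p → ℤ) → k) :=
  if i = 1 then
    if j = 1 then diagSeq β r else stepSeq β (fun _ _ => 1) (-1) r
  else if j = 1 then stepSeq β (upWeight β γ) 1 r
  -- T₁₁ is forced: the coefficient of v^p in the RTT relation of T₂₁(u) and T₁₂(v) reads T₁₁(u) =
  -- T₂₂(u) - [T₂₁(u), t₁₂⁽¹⁾].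
  else diagSeq β r - (stepSeq β (fun _ _ => 1) (-1) r * stepSeq β (upWeight β γ) 1 1
    - stepSeq β (upWeight β γ) 1 1 * stepSeq β (fun _ _ => 1) (-1) r)

/-- The generating function of `gtSeq`. -/
noncomputable def gt (β : Fin p → k) (γ : Fin (2 * p) → k) (i j : Fin 2) (u : k) :
    Module.End k ((Fin p → ℤ) → k) := ev p (gtSeq β γ i j) u

variable {β : Fin p → k} {γ : Fin (2 * p) → k}

theorem gt_one_one (u : k) : gt β γ 1 1 u = ev p (diagSeq β) u := rfl

theorem gt_one_zero (u : k) : gt β γ 1 0 u = ev p (stepSeq β (fun _ _ => 1) (-1)) u := rfl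

theorem gt_zero_one (u : k) : gt β γ 0 1 u = ev p (stepSeq β (upWeight β γ) 1) u := rfl

theorem gt_zero_zero (u : k) : gt β γ 0 0 u = gt β γ 1 1 u -
    (gt β γ 1 0 u * gtSeq β γ 0 1 1 - gtSeq β γ 0 1 1 * gt β γ 1 0 u) :=
  ev_sub_mul (diagSeq β) (stepSeq β (fun _ _ => 1) (-1)) _ u

theorem upWeight_single (x : Fin p → ℤ) {i j : Fin p} (h : j ≠ i) (s : ℤ) :
    upWeight β γ (x + Pi.single i s) j = upWeight β γ x j := by
  rw [upWeight, node_single_of_ne β x h, upWeight]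

/-- The commutator of `T₂₁(u)` and `T₁₂(v)` is diagonal in the interpolation basis. -/
theorem exists_commutator (hβ : ∀ x, Function.Injective (node β x)) (f : (Fin p → ℤ) → k)
    (x : Fin p → ℤ) : ∃ c : Fin p → k, ∀ u v,
      (gt β γ 1 0 u * gt β γ 0 1 v - gt β γ 0 1 v * gt β γ 1 0 u) f x =
        ∑ i, c i * (lag β x i).eval u * (lag β x i).eval v := by
  refine ⟨fun i => gt β γ 0 1 (node β x i) f (x + Pi.single i (-1))
    - upWeight β γ x i * gt β γ 1 0 (node β x i) f (x + Pi.single i 1), fun u v => ?_⟩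
  rw [LinearMap.sub_apply, Pi.sub_apply, gt_one_zero, gt_zero_one, ev_stepSeq_mul hβ,
    ev_stepSeq_mul hβ, Finset.sum_comm (s := Finset.univ) (t := Finset.univ) (f := fun i j =>
      (lag β x i).eval v * (lag β x j).eval u * _), ← Finset.sum_sub_distrib]
  refine Finset.sum_congr rfl fun i _ => ?_
  rw [← Finset.sum_sub_distrib, Finset.sum_eq_single i]
  · simp only [gt_zero_one, gt_one_zero]
    ring
  -- For i ≠ j the two moves commute, and the weight in one direction does not depend on the other
  -- coordinate, so these terms cancel.
  · intro j _ hj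
    rw [ev_stepSeq_shift hβ _ _ _ f x hj, ev_stepSeq_shift hβ _ _ _ f x hj.symm,
      upWeight_single x hj, add_right_comm]
    ring
  · simp

theorem lag_coeff (β : Fin p → k) (x : Fin p → ℤ) (i : Fin p) (u : k) :
    (u - node β x i) * (lag β x i).eval u =
      (lag β x i).coeff (p - 1) * (poly (shift β x)).eval u := by
  obtain ⟨Q, hm, hd, h1, h2, -⟩ := exists_factor_zero β x i
  rw [h1, h2, coeff_C_mul, ← hd, hm.coeff_natDegree, eval_mul, eval_C]
  ring

/-- Compare coefficients of v^(p-1), the place of t₁₂⁽¹⁾ in T₁₂(v). -/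
theorem commutator_one [CharZero k] (hp : 0 < p) (hβ : ∀ x, Function.Injective (node β x))
    {f : (Fin p → ℤ) → k} {x : Fin p → ℤ} {c : Fin p → k}
    (hc : ∀ u v, (gt β γ 1 0 u * gt β γ 0 1 v - gt β γ 0 1 v * gt β γ 1 0 u) f x =
        ∑ i, c i * (lag β x i).eval u * (lag β x i).eval v) (u : k) :
    (gt β γ 1 0 u * gtSeq β γ 0 1 1 - gtSeq β γ 0 1 1 * gt β γ 1 0 u) f x =
      ∑ i, c i * (lag β x i).eval u * (lag β x i).coeff (p - 1) := by
  rw [← sub_eq_zero]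
  refine eq_zero_of_ev (a := fun r =>
    (gt β γ 1 0 u * gtSeq β γ 0 1 r - gtSeq β γ 0 1 r * gt β γ 1 0 u) f x -
      ∑ i, c i * (lag β x i).eval u * (lag β x i).coeff (p - r))
    (Set.infinite_univ (α := k)) (fun v _ => ?_) 1 hp
  rw [ev_sub, sub_eq_zero]
  have h1 := hc u v
  rw [gt, gt, ev_mul_left, ev_mul_right, ← ev_sub, ev_apply] at h1
  refine h1.trans ?_
  have h2 : ∀ i, (lag β x i).natDegree ≤ p := fun i => by
    rw [lag, Lagrange.natDegree_basis (hβ x).injOn (Finset.mem_univ i)]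
    simp
  simp only [← fun i => ev_coeff (h2 i) v, ev, Finset.mul_sum, smul_eq_mul]
  rw [Finset.sum_comm]
  exact Finset.sum_congr rfl fun _ _ => Finset.sum_congr rfl fun _ _ => by ring

/-- In the expansion of `exists_commutator` the claim splits over i. Each summand follows from
`lag_coeff` at u and at v, since u - v is the difference of the distances of u and v from the i-th
node. -/
theorem gt_bc [CharZero k] (hp : 0 < p) (hβ : ∀ x, Function.Injective (node β x)) (u v : k) :
    RTTAt (gt β γ) 0 1 1 0 u v := by
  rw [RTTAt, gt_zero_zero, gt_zero_zero]
  ext f x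
  obtain ⟨c, hc⟩ := exists_commutator (γ := γ) hβ f x
  have h1 := hc v u
  have h2 := commutator_one hp hβ hc u
  have h3 := commutator_one hp hβ hc v
  rw [mul_sub (gt β γ 1 1 u), mul_sub (gt β γ 1 1 v), show gt β γ 1 1 u * gt β γ 1 1 v = gt β γ 1 1 v * gt β γ 1 1 u from
    diag_diag β u v, sub_sub_sub_cancel_left]
  rw [← neg_sub (gt β γ 1 0 v * gt β γ 0 1 u), smul_neg, LinearMap.neg_apply, LinearMap.smul_apply, Pi.neg_apply, Pi.smul_apply,
    h1, LinearMap.sub_apply, Pi.sub_apply, Module.End.mul_apply, Module.End.mul_apply, gt_one_one,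
    gt_one_one, ev_diagSeq, ev_diagSeq, h2, h3, smul_eq_mul, Finset.mul_sum, Finset.mul_sum,
    Finset.mul_sum, ← Finset.sum_sub_distrib, ← Finset.sum_neg_distrib]
  refine Finset.sum_congr rfl fun i _ => ?_
  linear_combination c i * (lag β x i).eval u * lag_coeff β x i v
    - c i * (lag β x i).eval v * lag_coeff β x i u

theorem node_ne_node_add_one (hβ : ∀ i j, i ≠ j → ∀ n : ℤ, β i - β j ≠ (n : k))
    (x : Fin p → ℤ) (i j : Fin p) : node β x i ≠ node β x j + 1 := by
  intro h
  rcases eq_or_ne i j with rfl | hij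
  · simp at h
  · refine hβ i j hij (x j - x i - 1) ?_
    simp only [node] at h
    push_cast
    linear_combination -h

/-- Two forms of the quantum determinant: one loses its T₁₁ term where T₂₂(u - 1) vanishes, the
other where T₂₂(u) does. -/
theorem gt_det_swap [CharZero k] (hp : 0 < p) (hβ : ∀ x, Function.Injective (node β x)) (u : k) :
    gt β γ 1 1 (u - 1) * gt β γ 0 0 u - gt β γ 1 0 (u - 1) * gt β γ 0 1 u =
      gt β γ 1 1 u * gt β γ 0 0 (u - 1) - gt β γ 0 1 u * gt β γ 1 0 (u - 1) := by
  have h := gt_bc (γ := γ) hp hβ u (u - 1)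
  rw [RTTAt, sub_sub_cancel, one_smul] at h
  rw [sub_eq_sub_iff_add_eq_add]
  rw [sub_eq_sub_iff_add_eq_add] at h
  rw [add_comm, ← h, add_comm]

theorem exists_gt_det_poly [CharZero k] (hp : 0 < p) (hβ : ∀ x, Function.Injective (node β x))
    (f : (Fin p → ℤ) → k) (x : Fin p → ℤ) : ∃ q : k[X], q.degree < (2 * p : ℕ) ∧ ∀ u, q.eval u =
      (gt β γ 1 1 (u - 1) * gt β γ 0 0 u - gt β γ 1 0 (u - 1) * gt β γ 0 1 u) f x
        - (poly γ).eval u * f x := by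
  obtain ⟨c, hc⟩ := exists_commutator (γ := γ) hβ f x
  have h2 := commutator_one hp hβ hc
  set P := poly (shift β x) with hP
  have hPm : P.Monic := poly_monic _
  have hPd : P.natDegree = p := poly_natDegree _
  have hP'm : (P.comp (X - C 1)).Monic := hPm.comp_X_sub_C 1
  have hP'd : (P.comp (X - C 1)).natDegree = p := by rw [natDegree_comp, natDegree_X_sub_C, hPd, mul_one]
  have hlag : ∀ i, (lag β x i).natDegree = p - 1 := fun i => by
    rw [lag, Lagrange.natDegree_basis (hβ x).injOn (Finset.mem_univ i)]
    simp
  have hlt : ∀ q : k[X], q.natDegree ≤ p + (p - 1) → q.degree < (2 * p : ℕ) := fun q hq =>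
    degree_le_natDegree.trans_lt (Nat.cast_lt.2 (by omega))
  refine ⟨f x • (P.comp (X - C 1) * P - poly γ)
    - P.comp (X - C 1) * ∑ i, C (c i * (lag β x i).coeff (p - 1)) * lag β x i
    - ∑ i, (lag β x i).comp (X - C 1) * stepPoly β (upWeight β γ) 1 f (x + Pi.single i (-1)),
    ?_, fun u => ?_⟩
  · refine (degree_sub_le _ _).trans_lt (max_lt ((degree_sub_le _ _).trans_lt (max_lt ?_ ?_)) ?_)
    -- Both polynomials are monic of degree 2p, so the leading terms cancel.
    · refine (degree_smul_le _ _).trans_lt ?_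
      have h1 : (P.comp (X - C 1) * P).Monic := hP'm.mul hPm
      have h3 : (P.comp (X - C 1) * P).natDegree = 2 * p := by
        rw [hP'm.natDegree_mul hPm, hPd, hP'd, two_mul]
      have h4 : (P.comp (X - C 1) * P).degree = (2 * p : ℕ) := by
        rw [degree_eq_natDegree h1.ne_zero, h3]
      have h5 : (poly γ).degree = (2 * p : ℕ) := by
        rw [degree_eq_natDegree (poly_monic γ).ne_zero, poly_natDegree]
      rw [← h4]
      exact degree_sub_lt_left (h4.trans h5.symm) h1.ne_zero
        (h1.leadingCoeff.trans (poly_monic γ).leadingCoeff.symm)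
    · refine hlt _ (natDegree_mul_le.trans (add_le_add hP'd.le ?_))
      exact natDegree_sum_le_of_forall_le _ _ fun i _ =>
        (natDegree_C_mul_le _ _).trans (hlag i).le
    · refine hlt _ (natDegree_sum_le_of_forall_le _ _ fun i _ => natDegree_mul_le.trans ?_)
      rw [add_comm p]
      refine add_le_add ?_ (natDegree_le_of_degree_le (degree_stepPoly_lt hβ _ _ _ _).le)
      rw [natDegree_comp, natDegree_X_sub_C, hlag, mul_one]
  · rw [LinearMap.sub_apply, Pi.sub_apply, Module.End.mul_apply, Module.End.mul_apply, gt_one_one,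
      ev_diagSeq, gt_zero_zero, LinearMap.sub_apply, Pi.sub_apply, h2, gt_one_one, ev_diagSeq,
      gt_one_zero, gt_zero_one, ev_stepSeq_apply hβ]
    simp only [ev_stepSeq hβ, eval_sub, eval_smul, smul_eq_mul, eval_mul, eval_comp, eval_C, eval_X, eval_finsetSum, ← hP,
      one_mul]
    rw [Finset.sum_congr rfl fun i _ => mul_right_comm (c i) _ _]
    ring

/-- The defect of the identity, applied to f at x, is a polynomial in u of degree below 2p. It
vanishes at the p nodes and at their translates by 1, which are 2p distinct points by genericity:
there the term with T₁₁ drops out and a step followed by its inverse gives exactly γ(u). -/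
theorem gt_det [CharZero k] (hp : 0 < p) (hβ : ∀ i j, i ≠ j → ∀ n : ℤ, β i - β j ≠ (n : k))
    (u : k) : gt β γ 1 1 (u - 1) * gt β γ 0 0 u
      = (poly γ).eval u • 1 + gt β γ 1 0 (u - 1) * gt β γ 0 1 u := by
  have hβ' := node_injective hβ
  rw [← sub_eq_iff_eq_add]
  ext f x
  obtain ⟨q, hq, hq'⟩ := exists_gt_det_poly (γ := γ) hp hβ' f x
  have hnodes : Function.Injective
      (Sum.elim (node β x) (fun i => node β x i + 1) : Fin p ⊕ Fin p → k) := by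
    refine (hβ' x).sumElim (fun i j h => hβ' x (add_right_cancel h)) fun i j =>
      node_ne_node_add_one hβ x i j
  have hq0 : q = 0 := by
    refine eq_zero_of_degree_lt_of_eval_index_eq_zero Finset.univ
      (v := (Sum.elim (node β x) (fun i => node β x i + 1) : Fin p ⊕ Fin p → k)) hnodes.injOn
      (by simpa [two_mul] using hq) ?_
    rintro (i | i) -
    · rw [hq', gt_det_swap hp hβ']
      rw [LinearMap.sub_apply, Pi.sub_apply, Module.End.mul_apply, Module.End.mul_apply, gt_one_one,
        ev_diagSeq, gt_zero_one, Sum.elim_inl, ev_stepSeq_node hβ']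
      have h1 : node β x i - 1 = node β (x + Pi.single i 1) i := by
        rw [node_single_self, Int.cast_one]
      rw [h1, gt_one_zero, ev_stepSeq_node hβ', eval_poly_shift,
        Finset.prod_eq_zero (Finset.mem_univ i) (sub_self _), add_assoc, ← Pi.single_add, upWeight]
      simp
    · rw [hq']
      rw [LinearMap.sub_apply, Pi.sub_apply, Module.End.mul_apply, Module.End.mul_apply, gt_one_one,
        ev_diagSeq, gt_one_zero, Sum.elim_inr, add_sub_cancel_right, ev_stepSeq_node hβ']
      have h1 : node β x i + 1 = node β (x + Pi.single i (-1)) i := by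
        rw [node_single_self]
        push_cast
        ring
      rw [h1, gt_zero_one, ev_stepSeq_node hβ', eval_poly_shift,
        Finset.prod_eq_zero (Finset.mem_univ i) (sub_self _), add_assoc, ← Pi.single_add, upWeight]
      simp
  have h := hq' u
  rw [hq0, eval_zero] at h
  rw [LinearMap.smul_apply, Pi.smul_apply, Module.End.one_apply, smul_eq_mul]
  exact (sub_eq_zero.1 h.symm)

theorem gt_preRTT [CharZero k] (hp : 0 < p) (hβ : ∀ i j, i ≠ j → ∀ n : ℤ, β i - β j ≠ (n : k)) :
    PreRTT (gt β γ) (fun u => (poly γ).eval u) where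
  dd := diag_diag β
  cc := ev_stepSeq_comm (node_injective hβ) fun _ _ _ _ => rfl
  bb := ev_stepSeq_comm (node_injective hβ) fun x _ _ h => upWeight_single x h 1
  cd := down_diag (node_injective hβ) _
  dc := diag_down (node_injective hβ) _
  bd := up_diag (node_injective hβ) _
  db := diag_up (node_injective hβ) _
  bc := gt_bc hp (node_injective hβ)
  det := gt_det hp hβ

/-- The points outside of the integral translates of the roots of `∏ i, (u + β i)`. -/
def regular (β : Fin p → k) : Set k := {u | ∀ i, ∀ n : ℤ, u + β i ≠ n}

theorem regular_sub_one {u : k} (hu : u ∈ regular β) : u - 1 ∈ regular β := by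
  intro i n h
  refine hu i (n + 1) ?_
  push_cast
  linear_combination h

theorem infinite_regular [CharZero k] (β : Fin p → k) : (regular β).Infinite := by
  have hinj : Function.Injective fun n : ℕ => (1 / (n + 2 : k)) := by
    intro m n h
    have hm : (m + 2 : k) ≠ 0 := by exact_mod_cast (Nat.succ_ne_zero (m + 1))
    have hn : (n + 2 : k) ≠ 0 := by exact_mod_cast (Nat.succ_ne_zero (n + 1))
    simp only [one_div, inv_inj, add_left_inj, Nat.cast_inj] at h
    exact h
  have hcl : ∀ m n : ℕ, ∀ z : ℤ, (1 / (m + 2 : k)) - 1 / (n + 2 : k) = z → m = n := by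
    intro m n z h
    have h' : (1 / (m + 2 : ℚ)) - 1 / (n + 2 : ℚ) = z := by
      have : (((1 / (m + 2 : ℚ)) - 1 / (n + 2 : ℚ) : ℚ) : k) = ((z : ℚ) : k) := by
        push_cast
        exact h
      exact_mod_cast this
    have hm : (0 : ℚ) < 1 / (m + 2) := by positivity
    have hn : (0 : ℚ) < 1 / (n + 2) := by positivity
    have hm' : (1 : ℚ) / (m + 2) < 1 := by
      rw [div_lt_one (by positivity)]
      linarith [Nat.cast_nonneg (α := ℚ) m]
    have hn' : (1 : ℚ) / (n + 2) < 1 := by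
      rw [div_lt_one (by positivity)]
      linarith [Nat.cast_nonneg (α := ℚ) n]
    have h1 : (z : ℚ) < 1 := by linarith
    have h2 : (-1 : ℚ) < z := by linarith
    have hz : z = 0 := by
      have h1' : z < 1 := by exact_mod_cast h1
      have h2' : -1 < z := by exact_mod_cast h2
      omega
    rw [hz, Int.cast_zero, sub_eq_zero] at h
    exact hinj h
  -- The numbers 1/(n+2) are pairwise incongruent modulo ℤ, so each β i excludes at most one n.
  have hfin : (⋃ i : Fin p, {n : ℕ | ∃ z : ℤ, 1 / (n + 2 : k) + β i = z}).Finite := by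
    refine Set.finite_iUnion fun i => Set.Subsingleton.finite ?_
    rintro m ⟨z, hz⟩ n ⟨z', hz'⟩
    refine hcl m n (z - z') ?_
    push_cast
    linear_combination hz - hz'
  refine (hfin.infinite_compl.image hinj.injOn).mono ?_
  rintro _ ⟨n, hn, rfl⟩ i z hz
  exact hn (Set.mem_iUnion.2 ⟨i, z, hz⟩)

theorem eval_poly_shift_ne_zero {u : k} (hu : u ∈ regular β) (x : Fin p → ℤ) :
    (poly (shift β x)).eval u ≠ 0 := by
  rw [eval_poly_shift, Finset.prod_ne_zero_iff]
  intro i _ h0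
  refine hu i (-x i) ?_
  simp only [node] at h0
  push_cast
  linear_combination h0

theorem isUnit_gt {u : k} (hu : u ∈ regular β) : IsUnit (gt β γ 1 1 u) := by
  have h := eval_poly_shift_ne_zero hu
  let g : Module.End k ((Fin p → ℤ) → k) :=
    LinearMap.pi fun x => ((poly (shift β x)).eval u)⁻¹ • LinearMap.proj x
  refine ⟨⟨gt β γ 1 1 u, g, ?_, ?_⟩, rfl⟩ <;>
  · ext f x
    rw [Module.End.mul_apply, gt_one_one]
    simp [g, h x, ev_diagSeq]

end GelfandTsetlinModule

/-! ### Values of the generators and representations of the Yangian -/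

section Generators

variable {k : Type*} [Field k] {p : ℕ}

theorem freeT_zero (i j : Fin 2) : freeT k p i j 0 = if i = j then 1 else 0 := by simp [freeT]

theorem freeT_of_lt (i j : Fin 2) {r : ℕ} (hr : p < r) : freeT k p i j r = 0 := by
  rw [freeT, if_neg (by omega), dif_neg (by omega)]

theorem t_zero (i j : Fin 2) : t k p i j 0 = if i = j then 1 else 0 := by
  rw [t, freeT_zero]
  split <;> simp

theorem t_of_lt (i j : Fin 2) {r : ℕ} (hr : p < r) : t k p i j r = 0 := by
  rw [t, freeT_of_lt i j hr, map_zero]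

theorem t_zero_comm (i j : Fin 2) (y : Y k p) : t k p i j 0 * y = y * t k p i j 0 := by
  rw [t_zero]
  split <;> simp

theorem t_rel (i j m l : Fin 2) (r s : ℕ) :
    (t k p i j (r + 1) * t k p m l s - t k p m l s * t k p i j (r + 1))
      - (t k p i j r * t k p m l (s + 1) - t k p m l (s + 1) * t k p i j r) =
    t k p m j r * t k p i l s - t k p m j s * t k p i l r := by
  have h := RingQuot.mkAlgHom_rel k (Rel.rel (k := k) (p := p) i j m l r s)
  simp only [map_sub, map_mul] at h
  exact h

/-- The value `T_{ij}(u)` of `T i j` at `u`. -/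
noncomputable def Tv (k : Type*) [Field k] (p : ℕ) (i j : Fin 2) (u : k) : Y k p :=
  ev p (t k p i j) u

theorem Tv_rtt (i j m l : Fin 2) (u v : k) : RTTAt (Tv k p) i j m l u v := by
  have h := ev_ev_rel (t_zero_comm i j) (t_zero_comm m l) (t_of_lt i j p.lt_succ_self)
    (t_of_lt m l p.lt_succ_self) (c := t k p m j) (d := t k p i l) u v
  simp only [t_rel, sub_self] at h
  rw [RTTAt, ← sub_eq_zero]
  refine h.symm.trans ?_
  simp [ev]

/-- Elements of an algebra satisfying the `RTT` relations at infinitely many points define a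
representation of the Yangian. -/
theorem exists_algHom {A : Type*} [Ring A] [Algebra k A] (a : Fin 2 → Fin 2 → ℕ → A)
    (h0 : ∀ i j, a i j 0 = if i = j then 1 else 0) (hlt : ∀ i j r, p < r → a i j r = 0)
    {S : Set k} (hS : S.Infinite)
    (h : ∀ u ∈ S, ∀ v ∈ S, ∀ i j m l, RTTAt (fun i j => ev p (a i j)) i j m l u v) :
    ∃ φ : Y k p →ₐ[k] A, ∀ i j r, φ (t k p i j r) = a i j r := by
  let φ₀ : FreeAlgebra k (Fin 2 × Fin 2 × Fin p) →ₐ[k] A :=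
    FreeAlgebra.lift k fun q => a q.1 q.2.1 (q.2.2 + 1)
  have hφ₀ : ∀ i j r, φ₀ (freeT k p i j r) = a i j r := by
    intro i j r
    rcases Nat.eq_zero_or_pos r with rfl | hr
    · rw [freeT_zero, h0]
      split <;> simp
    · rcases Nat.lt_or_ge p r with hpr | hpr
      · rw [freeT_of_lt i j hpr, hlt i j r hpr, map_zero]
      · rw [freeT, if_neg (by omega), dif_pos (by omega), FreeAlgebra.lift_ι_apply]
        simp only
        rw [Nat.sub_add_cancel hr]
  have h0c : ∀ i j y, a i j 0 * y = y * a i j 0 := by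
    intro i j y
    rw [h0]
    split <;> simp
  have hrel : ∀ x y, Rel k p x y → φ₀ x = φ₀ y := by
    rintro _ _ ⟨i, j, m, l, r, s⟩
    simp only [map_sub, map_mul, hφ₀]
    rcases Nat.lt_or_ge p r with hr | hr
    · simp [hlt _ _ r hr, hlt _ _ (r + 1) (by omega)]
    rcases Nat.lt_or_ge p s with hs | hs
    · simp [hlt _ _ s hs, hlt _ _ (s + 1) (by omega)]
    rw [← sub_eq_zero]
    let G : ℕ → ℕ → A := fun r s => ((a i j (r + 1) * a m l s - a m l s * a i j (r + 1))
      - (a i j r * a m l (s + 1) - a m l (s + 1) * a i j r))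
      - (a m j r * a i l s - a m j s * a i l r)
    -- The defects of the relations are the coefficients of a polynomial in u and v that vanishes on
    -- S × S with S infinite.
    have key : ∀ u ∈ S, ∀ v ∈ S, ev p (fun r => ev p (G r) v) u = 0 := by
      intro u hu v hv
      refine (ev_ev_rel (h0c i j) (h0c m l) (hlt i j _ p.lt_succ_self)
        (hlt m l _ p.lt_succ_self) u v).trans ?_
      have := h u hu v hv i j m l
      rw [RTTAt] at this
      rw [this, sub_self]
    exact eq_zero_of_ev (a := G r) hS (fun v hv =>
      eq_zero_of_ev (a := fun r => ev p (G r) v) hS (fun u hu => key u hu v hv) r hr) s hs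
  refine ⟨RingQuot.liftAlgHom k ⟨φ₀, hrel⟩, fun i j r => ?_⟩
  rw [t, RingQuot.liftAlgHom_mkAlgHom_apply, hφ₀]

/-- Evaluation of polynomials with coefficients in a `k`-algebra at elements of `k`. -/
noncomputable def evalHom {A : Type*} [Ring A] [Algebra k A] (u : k) : A[X] →+* A :=
  eval₂RingHom' (RingHom.id A) (algebraMap k A u) fun a => (Algebra.commutes u a).symm

theorem evalHom_C {A : Type*} [Ring A] [Algebra k A] (u : k) (a : A) : evalHom u (C a) = a :=
  eval₂_C _ _

theorem evalHom_X {A : Type*} [Ring A] [Algebra k A] (u : k) :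
    evalHom u (X : A[X]) = algebraMap k A u :=
  eval₂_X _ _

theorem evalHom_map {A : Type*} [Ring A] [Algebra k A] (u : k) (q : k[X]) :
    evalHom u (q.map (algebraMap k A)) = algebraMap k A (q.eval u) := by
  induction q using Polynomial.induction_on' with
  | add q r hq hr => simp [Polynomial.map_add, hq, hr]
  | monomial n a =>
    rw [← C_mul_X_pow_eq_monomial, Polynomial.map_mul, map_C, Polynomial.map_pow, map_X, map_mul,
      map_pow, evalHom_C, evalHom_X]
    simp

theorem evalHom_eq_sum {A : Type*} [Ring A] [Algebra k A] (u : k) (q : A[X]) {n : ℕ}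
    (h : q.natDegree < n) : evalHom u q = ∑ i ∈ Finset.range n, u ^ i • q.coeff i := by
  conv_lhs => rw [q.as_sum_range' n h]
  rw [map_sum]
  refine Finset.sum_congr rfl fun i _ => ?_
  rw [← C_mul_X_pow_eq_monomial, map_mul, map_pow, evalHom_C, evalHom_X, ← map_pow,
    ← Algebra.commutes, ← Algebra.smul_def]

theorem evalHom_comp {A : Type*} [Ring A] [Algebra k A] (u : k) (q : A[X]) :
    evalHom u (q.comp (X - 1)) = evalHom (u - 1) q := by
  induction q using Polynomial.induction_on' with
  | add q r hq hr => simp [add_comp, hq, hr]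
  | monomial n a =>
    rw [← C_mul_X_pow_eq_monomial, C_mul_comp, X_pow_comp, map_mul, map_mul, map_pow, map_pow,
      evalHom_C, evalHom_C, evalHom_X, map_sub, map_one, evalHom_X, map_sub, map_one]

theorem evalHom_T (i j : Fin 2) (u : k) : evalHom u (T k p i j) = Tv k p i j u := by
  rw [T, map_sum, Tv, ev]
  refine Finset.sum_congr rfl fun r _ => ?_
  rw [map_mul, map_pow, evalHom_C, evalHom_X, ← map_pow, ← Algebra.commutes, ← Algebra.smul_def]

/-- The value of the quantum determinant at `u`. -/
noncomputable def Dv (k : Type*) [Field k] (p : ℕ) (u : k) : Y k p :=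
  Tv k p 0 0 u * Tv k p 1 1 (u - 1) - Tv k p 1 0 u * Tv k p 0 1 (u - 1)

theorem evalHom_D (u : k) : evalHom u (D k p) = Dv k p u := by
  rw [D, map_sub, map_mul, map_mul, evalHom_comp, evalHom_comp]
  simp only [evalHom_T]
  rfl

/-- A vector is killed by the coefficients of a polynomial as soon as it is killed by infinitely
many of its values. -/
theorem coeff_smul_eq_zero_iff {A V : Type*} [Ring A] [Algebra k A] [AddCommGroup V] [Module k V]
    [Module A V] [IsScalarTower k A V] (q : A[X]) {S : Set k} (hS : S.Infinite) (w : V) :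
    (∀ n, q.coeff n • w = 0) ↔ ∀ u ∈ S, (evalHom u q : A) • w = 0 := by
  constructor
  · intro h u _
    rw [evalHom_eq_sum u q (Nat.lt_succ_self _), Finset.sum_smul]
    exact Finset.sum_eq_zero fun i _ => by rw [smul_assoc, h, smul_zero]
  · intro h n
    rcases Nat.lt_or_ge q.natDegree n with hn | hn
    · rw [coeff_eq_zero_of_natDegree_lt hn, zero_smul]
    · refine coeff_eq_zero_of_sum_pow_smul (g := fun i => q.coeff i • w) hS (fun u hu => ?_) n
        (Nat.lt_succ_of_le hn)
      rw [← h u hu, evalHom_eq_sum u q (Nat.lt_succ_self _), Finset.sum_smul]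
      exact Finset.sum_congr rfl fun i _ => (smul_assoc _ _ _).symm

end Generators

/-! ### Nonvanishing of the universal module -/

section Existence

theorem shift_zero {k : Type*} [Field k] {p : ℕ} (β : Fin p → k) : shift β 0 = β := by
  ext i
  simp [shift]

variable {k : Type*} [Field k] {p : ℕ}

/-- Common eigenvectors of `T₂₂(u)` and of `D(u)` with eigenvalues `∏ i, (u + β i)` and
`∏ j, (u + γ j)`. -/
theorem gens_smul_eq_zero_iff {V : Type*} [AddCommGroup V] [Module k V] [Module (Y k p) V]
    [IsScalarTower k (Y k p) V] (β : Fin p → k) (γ : Fin (2 * p) → k) {S : Set k} (hS : S.Infinite)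
    (w : V) : (∀ g ∈ gens β γ, g • w = 0) ↔ ∀ u ∈ S, Tv k p 1 1 u • w = (poly β).eval u • w ∧
      Dv k p u • w = (poly γ).eval u • w := by
  have h1 := coeff_smul_eq_zero_iff (T k p 1 1 - (poly β).map (algebraMap k (Y k p))) hS w
  have h2 := coeff_smul_eq_zero_iff (D k p - (poly γ).map (algebraMap k (Y k p))) hS w
  simp only [map_sub, evalHom_T, evalHom_D, evalHom_map, sub_smul, sub_eq_zero,
    algebraMap_smul] at h1 h2
  have h3 : (∀ g ∈ gens β γ, g • w = 0) ↔
      (∀ n, (T k p 1 1 - (poly β).map (algebraMap k (Y k p))).coeff n • w = 0) ∧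
      ∀ n, (D k p - (poly γ).map (algebraMap k (Y k p))).coeff n • w = 0 := by
    constructor
    · exact fun h => ⟨fun n => h _ (Or.inl ⟨n, rfl⟩), fun n => h _ (Or.inr ⟨n, rfl⟩)⟩
    · rintro ⟨ha, hb⟩ _ (⟨n, rfl⟩ | ⟨n, rfl⟩)
      · exact ha n
      · exact hb n
  rw [h3, h1, h2]
  exact ⟨fun h u hu => ⟨h.1 u hu, h.2 u hu⟩, fun h => ⟨fun u hu => (h u hu).1, fun u hu => (h u hu).2⟩⟩

/-- In the Gelfand–Tsetlin representation the delta function at 0 is killed by all the generators of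
the left ideal, but not by 1. -/
theorem one_notMem_leftIdeal [CharZero k] (hp : 0 < p) (β : Fin p → k) (γ : Fin (2 * p) → k)
    (hβ : ∀ i j, i ≠ j → ∀ n : ℤ, β i - β j ≠ (n : k)) : (1 : Y k p) ∉ leftIdeal β γ := by
  have hpre := gt_preRTT (γ := γ) hp hβ
  have h0 : ∀ i j, gtSeq β γ i j 0 = if i = j then 1 else 0 := by
    have hd : diagSeq β 0 = 1 := by
      ext f x
      rw [diagSeq_apply β (Nat.zero_le _), Nat.sub_zero, Module.End.one_apply]
      have h := (poly_monic (shift β x)).coeff_natDegree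
      rw [poly_natDegree] at h
      rw [h, mul_one]
    have hs : ∀ w s, stepSeq β w s 0 = 0 := by
      intro w s
      ext f x
      rw [stepSeq, opSeq_of_le (Nat.zero_le _), Nat.sub_zero]
      exact coeff_eq_zero_of_degree_lt (degree_stepPoly_lt (node_injective hβ) w s f x)
    intro i j
    fin_cases i <;> fin_cases j <;> simp [gtSeq, hd, hs]
  have hlt : ∀ i j r, p < r → gtSeq β γ i j r = 0 := by
    intro i j r hr
    fin_cases i <;> fin_cases j <;> simp [gtSeq, diagSeq, stepSeq, opSeq_of_lt hr]
  obtain ⟨φ, hφ⟩ := exists_algHom (gtSeq β γ) h0 hlt (infinite_regular β)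
    fun u hu v hv i j m l => hpre.rttAt (isUnit_gt (regular_sub_one hu))
      (isUnit_gt (regular_sub_one (regular_sub_one hu))) (isUnit_gt (regular_sub_one hv))
      (isUnit_gt (regular_sub_one (regular_sub_one hv))) i j m l
  have hφT : ∀ i j u, φ (Tv k p i j u) = gt β γ i j u := by
    intro i j u
    rw [Tv, ← AlgHom.toLinearMap_apply, map_ev]
    simp only [AlgHom.toLinearMap_apply, hφ]
    rfl
  let _ : Module (Y k p) ((Fin p → ℤ) → k) := Module.compHom _ φ.toRingHom
  have hsm : ∀ (y : Y k p) (f : (Fin p → ℤ) → k), y • f = φ y f := fun _ _ => rfl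
  have : IsScalarTower k (Y k p) ((Fin p → ℤ) → k) := ⟨fun a y f => by
    rw [hsm, hsm, map_smul, LinearMap.smul_apply]⟩
  have hgens : ∀ g ∈ gens β γ, g • (Pi.single 0 1 : (Fin p → ℤ) → k) = 0 := by
    rw [gens_smul_eq_zero_iff β γ (infinite_regular β)]
    intro u hu
    rw [hsm, hsm, hφT, Dv, map_sub, map_mul, map_mul, hφT, hφT, hφT, hφT,
      hpre.det_right (isUnit_gt (regular_sub_one hu))]
    refine ⟨?_, by simp⟩
    ext x
    rw [gt_one_one, ev_diagSeq, Pi.smul_apply, smul_eq_mul]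
    rcases eq_or_ne x 0 with rfl | hx
    · rw [shift_zero]
    · simp [hx]
  have hle : leftIdeal β γ ≤ LinearMap.ker (LinearMap.toSpanSingleton (Y k p) _
      (Pi.single 0 1 : (Fin p → ℤ) → k)) :=
    Submodule.span_le.2 fun g hg => by simpa using hgens g hg
  intro h1
  have := hle h1
  rw [LinearMap.mem_ker, LinearMap.toSpanSingleton_apply, one_smul] at this
  simpa using congrFun this 0

end Existence

/-! ### Weight vectors and the steps between them -/

section Weights

variable {k : Type*} [Field k] {p : ℕ}

theorem Tv_one_zero_comm [CharZero k] (u v : k) :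
    Tv k p 1 0 u * Tv k p 1 0 v = Tv k p 1 0 v * Tv k p 1 0 u := by
  have h1 := Tv_rtt (k := k) (p := p) 1 0 1 0 u v
  have h2 := Tv_rtt (k := k) (p := p) 1 0 1 0 v u
  unfold RTTAt at h1 h2
  have h3 : (2 : k) • (Tv k p 1 0 u * Tv k p 1 0 v - Tv k p 1 0 v * Tv k p 1 0 u) = 0 := by
    linear_combination (norm := module) h2 - h1
  exact sub_eq_zero.1 ((smul_eq_zero.1 h3).resolve_left two_ne_zero)

theorem Tv_zero_one_comm [CharZero k] (u v : k) :
    Tv k p 0 1 u * Tv k p 0 1 v = Tv k p 0 1 v * Tv k p 0 1 u := by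
  have h1 := Tv_rtt (k := k) (p := p) 0 1 0 1 u v
  have h2 := Tv_rtt (k := k) (p := p) 0 1 0 1 v u
  unfold RTTAt at h1 h2
  have h3 : (2 : k) • (Tv k p 0 1 u * Tv k p 0 1 v - Tv k p 0 1 v * Tv k p 0 1 u) = 0 := by
    linear_combination (norm := module) h2 - h1
  exact sub_eq_zero.1 ((smul_eq_zero.1 h3).resolve_left two_ne_zero)

theorem Dv_eq (u : k) :
    Dv k p u = Tv k p 0 0 (u - 1) * Tv k p 1 1 u - Tv k p 0 1 (u - 1) * Tv k p 1 0 u := by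
  have h := Tv_rtt (k := k) (p := p) 1 0 0 1 u (u - 1)
  unfold RTTAt at h
  unfold Dv
  linear_combination (norm := module) -h

theorem Dv_eq' (u : k) :
    Dv k p u = Tv k p 1 1 (u - 1) * Tv k p 0 0 u - Tv k p 1 0 (u - 1) * Tv k p 0 1 u := by
  have h := Tv_rtt (k := k) (p := p) 0 0 1 1 u (u - 1)
  unfold RTTAt at h
  unfold Dv
  linear_combination (norm := module) h

/-- The case u ≠ v suffices: v will be a node, and eigenvalues need only be tested at infinitely
many u. -/
theorem Dv_comm_one_zero [CharZero k] {u v : k} (huv : u ≠ v) :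
    Dv k p u * Tv k p 1 0 v = Tv k p 1 0 v * Dv k p u := by
  have h0 := Tv_rtt (k := k) (p := p) 1 0 1 1 u (u - 1)
  have h1 := Tv_rtt (k := k) (p := p) 1 0 1 1 v (u - 1)
  have h2 := Tv_rtt (k := k) (p := p) 0 0 1 0 u v
  have h3 := Tv_rtt (k := k) (p := p) 0 1 1 0 u v
  unfold RTTAt at h0 h1 h2 h3
  have h5 : (u - v) • (Dv k p u * Tv k p 1 0 v - Tv k p 1 0 v * Dv k p u) = 0 := by
    rw [Dv_eq']
    linear_combination (norm := (simp only [mul_sub, sub_mul, smul_mul_assoc, mul_smul_comm,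
      mul_assoc, smul_sub, zero_mul, mul_zero]; module))
      Tv k p 1 1 (u - 1) * h2 + h1 * Tv k p 0 0 u - Tv k p 1 0 (u - 1) * h3
      - (u - v) • (Tv_one_zero_comm (k := k) (p := p) (u - 1) v * Tv k p 0 1 u) - h0 * Tv k p 0 0 v
  exact sub_eq_zero.1 ((smul_eq_zero.1 h5).resolve_left (sub_ne_zero.2 huv))

theorem Dv_comm_zero_one [CharZero k] {u v : k} (huv : u ≠ v) :
    Dv k p u * Tv k p 0 1 v = Tv k p 0 1 v * Dv k p u := by
  have h0 := Tv_rtt (k := k) (p := p) 1 1 0 1 u (u - 1)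
  have h1 := Tv_rtt (k := k) (p := p) 0 1 1 1 v (u - 1)
  have h2 := Tv_rtt (k := k) (p := p) 0 0 0 1 u v
  have h3 := Tv_rtt (k := k) (p := p) 1 0 0 1 u v
  unfold RTTAt at h0 h1 h2 h3
  have h5 : (u - v) • (Dv k p u * Tv k p 0 1 v - Tv k p 0 1 v * Dv k p u) = 0 := by
    unfold Dv
    linear_combination (norm := (simp only [mul_sub, sub_mul, smul_mul_assoc, mul_smul_comm,
      mul_assoc, smul_sub, zero_mul, mul_zero]; module))
      h2 * Tv k p 1 1 (u - 1) + Tv k p 0 0 u * h1 - h3 * Tv k p 0 1 (u - 1)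
      - (u - v) • (Tv k p 1 0 u * Tv_zero_one_comm (k := k) (p := p) (u - 1) v)
      + Tv k p 0 0 v * h0
  exact sub_eq_zero.1 ((smul_eq_zero.1 h5).resolve_left (sub_ne_zero.2 huv))


variable {V : Type*} [AddCommGroup V] [Module k V] [Module (Y k p) V]

/-- `w` is a weight vector of weight `x`: an eigenvector of `T₂₂(u)` and `D(u)` with eigenvalues
`∏ i, (u + β i + x i)` and `∏ j, (u + γ j)`. -/
def HasWeight (β : Fin p → k) (γ : Fin (2 * p) → k) (x : Fin p → ℤ) (w : V) : Prop :=
  ∀ g ∈ gens (shift β x) γ, g • w = 0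

variable {β : Fin p → k} {γ : Fin (2 * p) → k}

variable [IsScalarTower k (Y k p) V]

theorem smul_smul_comm (c : k) (y : Y k p) (w : V) : y • c • w = c • y • w := by
  rw [← algebraMap_smul (Y k p) c w, ← mul_smul, ← Algebra.commutes, mul_smul, algebraMap_smul]

theorem HasWeight.smul {x : Fin p → ℤ} {w : V} (h : HasWeight β γ x w) (c : k) :
    HasWeight β γ x (c • w) := fun g hg => by
  rw [smul_smul_comm, h g hg, smul_zero]

theorem hasWeight_iff {x : Fin p → ℤ} {w : V} {S : Set k} (hS : S.Infinite) :
    HasWeight β γ x w ↔ ∀ u ∈ S, Tv k p 1 1 u • w = (poly (shift β x)).eval u • w ∧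
      Dv k p u • w = (poly γ).eval u • w :=
  gens_smul_eq_zero_iff _ _ hS w

variable [CharZero k]

theorem HasWeight.T_smul {x : Fin p → ℤ} {w : V} (h : HasWeight β γ x w) (u : k) :
    Tv k p 1 1 u • w = (poly (shift β x)).eval u • w :=
  ((hasWeight_iff Set.infinite_univ).1 h u trivial).1

theorem HasWeight.D_smul {x : Fin p → ℤ} {w : V} (h : HasWeight β γ x w) (u : k) :
    Dv k p u • w = (poly γ).eval u • w :=
  ((hasWeight_iff Set.infinite_univ).1 h u trivial).2

theorem HasWeight.T_smul_node {x : Fin p → ℤ} {w : V} (h : HasWeight β γ x w) (i : Fin p) :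
    Tv k p 1 1 (node β x i) • w = 0 := by
  rw [h.T_smul, eval_poly_shift, Finset.prod_eq_zero (Finset.mem_univ i) (sub_self _), zero_smul]

/-- One term of the RTT relation of T₂₁(node) and T₂₂(u) disappears because T₂₂(node) kills w.
Dividing by u - node leaves the old eigenvalue with the factor u - node replaced by u - node + 1. -/
theorem HasWeight.up {x : Fin p → ℤ} {w : V} (h : HasWeight β γ x w) (i : Fin p) :
    HasWeight β γ (x + Pi.single i 1) (Tv k p 1 0 (node β x i) • w) := by
  rw [hasWeight_iff (S := {node β x i}ᶜ) (Set.finite_singleton _).infinite_compl]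
  intro u hu
  have hu' : u ≠ node β x i := hu
  constructor
  · have h1 := congrArg (· • w) (Tv_rtt (k := k) (p := p) 1 0 1 1 (node β x i) u)
    simp only [sub_smul, smul_sub, mul_smul, smul_assoc, h.T_smul_node, h.T_smul u, smul_zero] at h1
    obtain ⟨Q, -, -, -, h2, h3⟩ := exists_factor_zero β x i
    rw [h2] at h1
    rw [h3, ← sub_eq_zero]
    refine (smul_eq_zero.1 ?_).resolve_left (sub_ne_zero.2 hu')
    simp only [smul_smul_comm] at h1
    push_cast
    generalize Tv k p 1 1 u • Tv k p 1 0 (node β x i) • w = y at h1 ⊢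
    generalize Tv k p 1 0 (node β x i) • w = z at h1 ⊢
    linear_combination (norm := module) h1
  · rw [← mul_smul, Dv_comm_one_zero hu', mul_smul, h.D_smul, smul_smul_comm]

theorem HasWeight.down {x : Fin p → ℤ} {w : V} (h : HasWeight β γ x w) (i : Fin p) :
    HasWeight β γ (x + Pi.single i (-1)) (Tv k p 0 1 (node β x i) • w) := by
  rw [hasWeight_iff (S := {node β x i}ᶜ) (Set.finite_singleton _).infinite_compl]
  intro u hu
  have hu' : u ≠ node β x i := hu
  constructor
  · have h1 := congrArg (· • w) (Tv_rtt (k := k) (p := p) 1 1 0 1 u (node β x i))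
    simp only [sub_smul, smul_sub, mul_smul, smul_assoc, h.T_smul_node, h.T_smul u, smul_zero] at h1
    obtain ⟨Q, -, -, -, h2, h3⟩ := exists_factor_zero β x i
    rw [h2] at h1
    rw [h3, ← sub_eq_zero]
    refine (smul_eq_zero.1 ?_).resolve_left (sub_ne_zero.2 hu')
    simp only [smul_smul_comm] at h1
    push_cast
    generalize Tv k p 1 1 u • Tv k p 0 1 (node β x i) • w = y at h1 ⊢
    generalize Tv k p 0 1 (node β x i) • w = z at h1 ⊢
    linear_combination (norm := module) h1
  · rw [← mul_smul, Dv_comm_zero_one hu', mul_smul, h.D_smul, smul_smul_comm]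

theorem HasWeight.down_up {x : Fin p → ℤ} {w : V} (h : HasWeight β γ x w) (i : Fin p) :
    Tv k p 0 1 (node β x i - 1) • Tv k p 1 0 (node β x i) • w =
      -(poly γ).eval (node β x i) • w := by
  have h1 := h.D_smul (node β x i)
  rw [Dv_eq, sub_smul, mul_smul, mul_smul, h.T_smul_node, smul_zero, zero_sub] at h1
  rw [neg_smul, ← h1, neg_neg]

theorem HasWeight.up_down {x : Fin p → ℤ} {w : V} (h : HasWeight β γ x w) (i : Fin p) :
    Tv k p 1 0 (node β x i + 1) • Tv k p 0 1 (node β x i) • w =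
      -(poly γ).eval (node β x i + 1) • w := by
  have h1 := h.D_smul (node β x i + 1)
  rw [Dv, add_sub_cancel_right, sub_smul, mul_smul, mul_smul, h.T_smul_node, smul_zero,
    zero_sub] at h1
  rw [neg_smul, ← h1, neg_neg]

/-- The right-hand side of the RTT relation consists of products ending in T₂₂ at a node, which kill
w. -/
theorem HasWeight.up_down_comm {x : Fin p → ℤ} {w : V} (h : HasWeight β γ x w) {i j : Fin p}
    (hij : node β x i ≠ node β x j) :
    Tv k p 1 0 (node β x i) • Tv k p 0 1 (node β x j) • w =
      Tv k p 0 1 (node β x j) • Tv k p 1 0 (node β x i) • w := by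
  have h1 := congrArg (· • w) (Tv_rtt (k := k) (p := p) 1 0 0 1 (node β x i) (node β x j))
  simp only [sub_smul (Tv k p 1 0 _ * _), sub_smul (Tv k p 0 0 _ * _), smul_assoc, mul_smul,
    h.T_smul_node, smul_zero, sub_self] at h1
  exact sub_eq_zero.1 ((smul_eq_zero.1 h1).resolve_left (sub_ne_zero.2 hij))

/-- Products of values of `T₂₁` or of `T₁₂` that move the weight `0` by `n eᵢ`. -/
noncomputable def word (β : Fin p → k) (i : Fin p) : ℤ → Y k p
  | Int.ofNat m => Nat.rec 1 (fun n y => Tv k p 1 0 (-β i - n) * y) m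
  | Int.negSucc m => Nat.rec (Tv k p 0 1 (-β i))
      (fun n y => Tv k p 0 1 (-β i + (n + 1 : ℕ)) * y) m

theorem word_zero (β : Fin p → k) (i : Fin p) : word β i 0 = 1 := rfl

theorem word_succ (β : Fin p → k) (i : Fin p) {n : ℤ} (hn : 0 ≤ n) :
    word β i (n + 1) = Tv k p 1 0 (-β i - n) * word β i n := by
  obtain ⟨m, rfl⟩ := Int.eq_ofNat_of_zero_le hn
  rw [Int.cast_natCast]
  rfl

theorem word_pred (β : Fin p → k) (i : Fin p) {n : ℤ} (hn : n ≤ 0) :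
    word β i (n - 1) = Tv k p 0 1 (-β i - n) * word β i n := by
  obtain ⟨m, rfl⟩ := Int.exists_eq_neg_ofNat hn
  rcases m with _ | m
  · simp [word_zero]
    rfl
  · rw [show -((m + 1 : ℕ) : ℤ) - 1 = Int.negSucc (m + 1) by omega,
      show -((m + 1 : ℕ) : ℤ) = Int.negSucc m by omega]
    have h : -β i - ((Int.negSucc m : ℤ) : k) = -β i + ((m + 1 : ℕ) : k) := by
      rw [Int.cast_negSucc, sub_neg_eq_add]
    rw [h]
    rfl

theorem node_eq (β : Fin p → k) {x : Fin p → ℤ} {i : Fin p} {n : ℤ} (h : x i = n) :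
    node β x i = -β i - n := by
  rw [node, h]
  ring

theorem word_induction {C : ℤ → Prop} (h0 : C 0) (hs : ∀ n, 0 ≤ n → C n → C (n + 1))
    (hp : ∀ n ≤ 0, C n → C (n - 1)) (n : ℤ) : C n := by
  induction n using Int.induction_on with
  | zero => exact h0
  | succ n ih => exact hs n (Int.natCast_nonneg n) ih
  | pred n ih => exact hp (-n) (by omega) ih

theorem HasWeight.word {x : Fin p → ℤ} {w : V} (h : HasWeight β γ x w) {i : Fin p} (hi : x i = 0)
    (n : ℤ) : HasWeight β γ (x + Pi.single i n) (word β i n • w) := by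
  induction n using word_induction with
  | h0 => simpa [word_zero] using h
  | hs n hn ih =>
    have := ih.up i
    rwa [node_eq β (n := n) (by simp [hi]), ← mul_smul, ← word_succ β i hn, add_assoc,
      ← Pi.single_add] at this
  | hp n hn ih =>
    have := ih.down i
    rwa [node_eq β (n := n) (by simp [hi]), ← mul_smul, ← word_pred β i hn, add_assoc,
      ← Pi.single_add, ← sub_eq_add_neg] at this

/-- The coefficient of the step from the coordinate `n` of the weight to `n + 1`. -/
noncomputable def upCoeff (β : Fin p → k) (γ : Fin (2 * p) → k) (i : Fin p) (n : ℤ) : k :=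
  if 0 ≤ n then 1 else -(poly γ).eval (-β i - n)

/-- The coefficient of the step from the coordinate `n` of the weight to `n - 1`. -/
noncomputable def downCoeff (β : Fin p → k) (γ : Fin (2 * p) → k) (i : Fin p) (n : ℤ) : k :=
  if n ≤ 0 then 1 else -(poly γ).eval (-β i - n + 1)

/-- A step away from 0 lengthens the word, with coefficient 1. A step towards 0 cancels the last
letter of the word by `up_down`, at the price of a value of -γ. -/
theorem HasWeight.up_word {x : Fin p → ℤ} {w : V} (h : HasWeight β γ x w) {i : Fin p}
    (hi : x i = 0) (n : ℤ) : Tv k p 1 0 (-β i - n) • Yangian.word β i n • w =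
      upCoeff β γ i n • Yangian.word β i (n + 1) • w := by
  rw [upCoeff]
  split_ifs with hn
  · rw [word_succ β i hn, one_smul, mul_smul]
  · have h1 := (h.word hi (n + 1)).up_down i
    rw [node_eq β (n := n + 1) (by simp [hi])] at h1
    have h2 := word_pred β i (n := n + 1) (by omega)
    rw [add_sub_cancel_right] at h2
    have h3 : -β i - ((n + 1 : ℤ) : k) + 1 = -β i - n := by push_cast; ring
    rw [h2, mul_smul, ← h3, h1]

theorem HasWeight.down_word {x : Fin p → ℤ} {w : V} (h : HasWeight β γ x w) {i : Fin p}
    (hi : x i = 0) (n : ℤ) : Tv k p 0 1 (-β i - n) • Yangian.word β i n • w =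
      downCoeff β γ i n • Yangian.word β i (n - 1) • w := by
  rw [downCoeff]
  split_ifs with hn
  · rw [word_pred β i hn, one_smul, mul_smul]
  · have h1 := (h.word hi (n - 1)).down_up i
    rw [node_eq β (n := n - 1) (by simp [hi])] at h1
    have h2 := word_succ β i (n := n - 1) (by omega)
    rw [sub_add_cancel] at h2
    have h3 : -β i - ((n - 1 : ℤ) : k) - 1 = -β i - n := by push_cast; ring
    have h4 : -β i - ((n - 1 : ℤ) : k) = -β i - n + 1 := by push_cast; ring
    rw [h3] at h1
    rw [h2, mul_smul, h1, h4]

theorem HasWeight.up_word_comm (hβ : ∀ x, Function.Injective (node β x)) {x : Fin p → ℤ} {w : V}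
    (h : HasWeight β γ x w) {i j : Fin p} (hi : x i = 0) (hij : j ≠ i) (n : ℤ) :
    Tv k p 1 0 (node β x j) • Yangian.word β i n • w =
      Yangian.word β i n • Tv k p 1 0 (node β x j) • w := by
  induction n using word_induction with
  | h0 => simp [word_zero]
  | hs n hn ih =>
    rw [word_succ β i hn, mul_smul, mul_smul, ← ih, ← mul_smul, Tv_one_zero_comm, mul_smul]
  | hp n hn ih =>
    rw [word_pred β i hn, mul_smul, mul_smul, ← ih]
    have h1 := (h.word hi n).up_down_comm (i := j) (j := i) fun h => hij (hβ _ h)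
    rwa [node_single_of_ne β x hij, node_eq β (i := i) (n := n) (by simp [hi])] at h1

theorem HasWeight.down_word_comm (hβ : ∀ x, Function.Injective (node β x)) {x : Fin p → ℤ} {w : V}
    (h : HasWeight β γ x w) {i j : Fin p} (hi : x i = 0) (hij : j ≠ i) (n : ℤ) :
    Tv k p 0 1 (node β x j) • Yangian.word β i n • w =
      Yangian.word β i n • Tv k p 0 1 (node β x j) • w := by
  induction n using word_induction with
  | h0 => simp [word_zero]
  | hs n hn ih =>
    rw [word_succ β i hn, mul_smul, mul_smul, ← ih]
    have h1 := (h.word hi n).up_down_comm (i := i) (j := j) fun h => hij (hβ _ h).symm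
    rw [node_single_of_ne β x hij, node_eq β (i := i) (n := n) (by simp [hi])] at h1
    exact h1.symm
  | hp n hn ih =>
    rw [word_pred β i hn, mul_smul, mul_smul, ← ih, ← mul_smul, Tv_zero_one_comm, mul_smul]

/-- The weight vector of weight `x` (with the coordinates outside of `l` replaced by `0`) obtained
from the vector `v` of weight `0`. -/
noncomputable def wordVec (β : Fin p → k) (v : V) (l : List (Fin p)) (x : Fin p → ℤ) : V :=
  l.foldr (fun i w => Yangian.word β i (x i) • w) v

theorem wordVec_cons (v : V) (i : Fin p) (l : List (Fin p)) (x : Fin p → ℤ) :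
    wordVec β v (i :: l) x = Yangian.word β i (x i) • wordVec β v l x := rfl

theorem wordVec_single_of_notMem (v : V) {l : List (Fin p)} {i : Fin p} (hi : i ∉ l)
    (x : Fin p → ℤ) (s : ℤ) : wordVec β v l (x + Pi.single i s) = wordVec β v l x := by
  induction l with
  | nil => rfl
  | cons j l ih =>
    rw [List.mem_cons, not_or] at hi
    rw [wordVec_cons, wordVec_cons, ih hi.2]
    simp [Ne.symm hi.1]

theorem wordVec_zero (v : V) (l : List (Fin p)) : wordVec β v l 0 = v := by
  induction l with
  | nil => rfl
  | cons j l ih => rw [wordVec_cons, ih, Pi.zero_apply, word_zero, one_smul]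

theorem hasWeight_wordVec {v : V} (hv : HasWeight β γ 0 v) {l : List (Fin p)} (hl : l.Nodup)
    (x : Fin p → ℤ) : HasWeight β γ (fun j => if j ∈ l then x j else 0) (wordVec β v l x) := by
  induction l with
  | nil =>
    convert hv using 1
    · ext j
      simp
    · rfl
  | cons i l ih =>
    rw [List.nodup_cons] at hl
    have h := (ih hl.2).word (i := i) (if_neg hl.1) (x i)
    rw [wordVec_cons]
    convert h using 1
    ext j
    rcases eq_or_ne j i with rfl | hj
    · simp [hl.1]
    · simp [hj]

theorem up_wordVec (hβ : ∀ x, Function.Injective (node β x)) {v : V} (hv : HasWeight β γ 0 v)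
    {l : List (Fin p)} (hl : l.Nodup) (x : Fin p → ℤ) {j : Fin p} (hj : j ∈ l) :
    Tv k p 1 0 (node β x j) • wordVec β v l x =
      upCoeff β γ j (x j) • wordVec β v l (x + Pi.single j 1) := by
  induction l with
  | nil => simp at hj
  | cons i l ih =>
    rw [List.nodup_cons] at hl
    have h := hasWeight_wordVec hv hl.2 x
    rw [wordVec_cons, wordVec_cons]
    rcases eq_or_ne j i with rfl | hji
    · rw [node_eq β rfl, h.up_word (if_neg hl.1), wordVec_single_of_notMem _ hl.1]
      simp
    · have hj' := (List.mem_cons.1 hj).resolve_left hji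
      have h1 := h.up_word_comm hβ (i := i) (if_neg hl.1) hji (x i)
      rw [node_eq β (if_pos hj'), ← node_eq β rfl, ih hl.2 hj', smul_smul_comm] at h1
      rw [h1]
      simp [Ne.symm hji]

theorem down_wordVec (hβ : ∀ x, Function.Injective (node β x)) {v : V} (hv : HasWeight β γ 0 v)
    {l : List (Fin p)} (hl : l.Nodup) (x : Fin p → ℤ) {j : Fin p} (hj : j ∈ l) :
    Tv k p 0 1 (node β x j) • wordVec β v l x =
      downCoeff β γ j (x j) • wordVec β v l (x + Pi.single j (-1)) := by
  induction l with
  | nil => simp at hj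
  | cons i l ih =>
    rw [List.nodup_cons] at hl
    have h := hasWeight_wordVec hv hl.2 x
    rw [wordVec_cons, wordVec_cons]
    rcases eq_or_ne j i with rfl | hji
    · rw [node_eq β rfl, h.down_word (if_neg hl.1), wordVec_single_of_notMem _ hl.1]
      simp [sub_eq_add_neg]
    · have hj' := (List.mem_cons.1 hj).resolve_left hji
      have h1 := h.down_word_comm hβ (i := i) (if_neg hl.1) hji (x i)
      rw [node_eq β (if_pos hj'), ← node_eq β rfl, ih hl.2 hj', smul_smul_comm] at h1
      rw [h1]
      simp [Ne.symm hji]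

/-- Vectors `w x` of weight `x` that the values of `T₂₁` and `T₁₂` at the nodes permute up to the
coefficients `upCoeff` and `downCoeff`. -/
structure IsWeightSystem (β : Fin p → k) (γ : Fin (2 * p) → k) (w : (Fin p → ℤ) → V) : Prop where
  hasWeight : ∀ x, HasWeight β γ x (w x)
  up : ∀ x j, Tv k p 1 0 (node β x j) • w x = upCoeff β γ j (x j) • w (x + Pi.single j 1)
  down : ∀ x j, Tv k p 0 1 (node β x j) • w x = downCoeff β γ j (x j) • w (x + Pi.single j (-1))

theorem exists_isWeightSystem (hβ : ∀ x, Function.Injective (node β x)) {v : V}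
    (hv : HasWeight β γ 0 v) : ∃ w : (Fin p → ℤ) → V, IsWeightSystem β γ w ∧ w 0 = v := by
  refine ⟨wordVec β v (List.finRange p), ⟨fun x => ?_, fun x j => ?_, fun x j => ?_⟩,
    wordVec_zero v _⟩
  · simpa using hasWeight_wordVec hv (List.nodup_finRange p) x
  · exact up_wordVec hβ hv (List.nodup_finRange p) x (List.mem_finRange j)
  · exact down_wordVec hβ hv (List.nodup_finRange p) x (List.mem_finRange j)

end Weights

/-! ### Spans of weight vectors and separation of weights -/

section Span

variable {k : Type*} [Field k] {p : ℕ}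

/-- Since `a 0 = 0`, the degree is below p and p points suffice. This applies to the off-diagonal
entries. -/
theorem eq_zero_of_ev_nodes {V : Type*} [AddCommGroup V] [Module k V] {b : Fin p → k}
    (hb : Function.Injective b) {a : ℕ → V} (h0 : a 0 = 0) (h : ∀ i, ev p a (b i) = 0) :
    ∀ r ≤ p, a r = 0 := by
  intro r hr
  rw [← Module.forall_dual_apply_eq_zero_iff k]
  intro φ
  have hcoeff : ∀ n ≤ p, (∑ r ∈ Finset.range (p + 1), C (φ (a r)) * X ^ (p - r)).coeff n
      = φ (a (p - n)) := by
    intro n hn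
    rw [finsetSum_coeff, Finset.sum_eq_single (p - n)]
    · simp [coeff_X_pow, Nat.sub_sub_self hn]
    · intro s hs hsn
      rw [Finset.mem_range] at hs
      rw [coeff_C_mul, coeff_X_pow, if_neg (by omega), mul_zero]
    · intro hn
      simp at hn
  have hdeg : (∑ r ∈ Finset.range (p + 1), C (φ (a r)) * X ^ (p - r)).degree < (p : WithBot ℕ) := by
    rw [degree_lt_iff_coeff_zero]
    intro n hn
    rcases hn.eq_or_lt with rfl | hn
    · rw [hcoeff _ le_rfl, Nat.sub_self, h0, map_zero]
    · refine coeff_eq_zero_of_natDegree_lt (lt_of_le_of_lt ?_ hn)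
      exact natDegree_sum_le_of_forall_le _ _ fun r _ =>
        (natDegree_C_mul_X_pow_le _ _).trans (by omega)
  have hzero := eq_zero_of_degree_lt_of_eval_index_eq_zero Finset.univ (v := b) hb.injOn
    (by simpa using hdeg) fun i _ => by
      have := congrArg φ (h i)
      simp only [ev, map_sum, map_smul, map_zero, smul_eq_mul] at this
      simp only [eval_finsetSum, eval_mul, eval_C, eval_pow, eval_X]
      rw [← this]
      exact Finset.sum_congr rfl fun _ _ => mul_comm _ _
  have := hcoeff (p - r) (by omega)
  rwa [hzero, coeff_zero, Nat.sub_sub_self hr, eq_comm] at this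

theorem adjoin_t : Algebra.adjoin k {y | ∃ i j r, y = t k p i j r} = ⊤ := by
  rw [eq_top_iff]
  rintro y -
  obtain ⟨z, rfl⟩ := RingQuot.mkAlgHom_surjective k (Rel k p) y
  induction z using FreeAlgebra.induction with
  | grade0 c =>
    rw [AlgHom.commutes]
    exact Subalgebra.algebraMap_mem _ c
  | grade1 q =>
    refine Algebra.subset_adjoin ⟨q.1, q.2.1, q.2.2 + 1, ?_⟩
    rw [t, freeT, if_neg (Nat.succ_ne_zero _), dif_pos (by simp)]
    rfl
  | mul a b ha hb =>
    rw [map_mul]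
    exact Subalgebra.mul_mem _ ha hb
  | add a b ha hb =>
    rw [map_add]
    exact Subalgebra.add_mem _ ha hb

variable {V : Type*} [AddCommGroup V] [Module k V] [Module (Y k p) V]
  [IsScalarTower k (Y k p) V]

theorem smul_mem_of_t_smul_mem (K : Submodule k V)
    (h : ∀ i j r, r ≤ p → ∀ w ∈ K, t k p i j r • w ∈ K) (y : Y k p) {w : V} (hw : w ∈ K) :
    y • w ∈ K := by
  have hy : y ∈ Algebra.adjoin k {y | ∃ i j r, y = t k p i j r} := adjoin_t (k := k) ▸ trivial
  induction hy using Algebra.adjoin_induction generalizing w with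
  | mem y hy =>
    obtain ⟨i, j, r, rfl⟩ := hy
    rcases Nat.lt_or_ge p r with hr | hr
    · rw [t_of_lt i j hr, zero_smul]
      exact K.zero_mem
    · exact h i j r hr w hw
  | algebraMap c =>
    rw [algebraMap_smul]
    exact K.smul_mem c hw
  | add y z _ _ hy hz =>
    rw [add_smul]
    exact K.add_mem (hy hw) (hz hw)
  | mul y z _ _ hy hz =>
    rw [mul_smul]
    exact hy (hz hw)

theorem ev_smul (a : ℕ → Y k p) (u : k) (w : V) : ev p a u • w = ev p (fun r => a r • w) u := by
  simp [ev, Finset.sum_smul]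

theorem ev_mem {W : Type*} [AddCommGroup W] [Module k W] {K : Submodule k W} {a : ℕ → W}
    (h : ∀ r ≤ p, a r ∈ K) (u : k) : ev p a u ∈ K :=
  K.sum_mem fun r hr => K.smul_mem _ (h r (Nat.lt_succ_iff.1 (Finset.mem_range.1 hr)))

theorem mem_of_ev_mem {W : Type*} [AddCommGroup W] [Module k W] {K : Submodule k W} {a : ℕ → W}
    {S : Set k} (hS : S.Infinite) (h : ∀ u ∈ S, ev p a u ∈ K) : ∀ r ≤ p, a r ∈ K := by
  intro r hr
  rw [← Submodule.Quotient.mk_eq_zero]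
  refine eq_zero_of_ev (a := fun r => K.mkQ (a r)) hS (fun u hu => ?_) r hr
  rw [← map_ev]
  simpa using h u hu

theorem mem_of_ev_nodes_mem {W : Type*} [AddCommGroup W] [Module k W] {K : Submodule k W}
    {b : Fin p → k} (hb : Function.Injective b) {a : ℕ → W} (h0 : a 0 = 0)
    (h : ∀ i, ev p a (b i) ∈ K) : ∀ r ≤ p, a r ∈ K := by
  intro r hr
  rw [← Submodule.Quotient.mk_eq_zero]
  refine eq_zero_of_ev_nodes (a := fun r => K.mkQ (a r)) hb (by simp [h0]) (fun i => ?_) r hr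
  rw [← map_ev]
  simpa using h i

theorem forall_span_smul_mem {K : Submodule k V} {s : Set V} (hs : Submodule.span k s = K)
    {y : Y k p} (h : ∀ w ∈ s, y • w ∈ K) : ∀ w ∈ K, y • w ∈ K := by
  intro w hw
  rw [← hs] at hw
  induction hw using Submodule.span_induction with
  | mem w hw => exact h w hw
  | zero =>
    rw [smul_zero]
    exact K.zero_mem
  | add v w _ _ hv hw =>
    rw [smul_add]
    exact K.add_mem hv hw
  | smul c w _ hw =>
    rw [smul_smul_comm]
    exact K.smul_mem c hw

variable [CharZero k] {β : Fin p → k} {γ : Fin (2 * p) → k} {w : (Fin p → ℤ) → V}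

/-- The span of a family of weight vectors that the values of `T₂₁` and `T₁₂` at the nodes
preserve is a submodule. -/
theorem smul_mem_span (hβ : ∀ x, Function.Injective (node β x)) (hw : IsWeightSystem β γ w)
    {Ω : Set (Fin p → ℤ)}
    (hup : ∀ x ∈ Ω, ∀ i, x + Pi.single i 1 ∈ Ω ∨ upCoeff β γ i (x i) = 0)
    (hdown : ∀ x ∈ Ω, ∀ i, x + Pi.single i (-1) ∈ Ω ∨ downCoeff β γ i (x i) = 0)
    (y : Y k p) {v : V} (hv : v ∈ Submodule.span k (w '' Ω)) :
    y • v ∈ Submodule.span k (w '' Ω) := by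
  set K := Submodule.span k (w '' Ω) with hK
  have hmem : ∀ x ∈ Ω, w x ∈ K := fun x hx => Submodule.subset_span ⟨x, hx, rfl⟩
  have h10 : ∀ r ≤ p, ∀ v ∈ K, t k p 1 0 r • v ∈ K := by
    intro r hr
    refine forall_span_smul_mem hK.symm ?_
    rintro _ ⟨x, hx, rfl⟩
    refine mem_of_ev_nodes_mem (a := fun r => t k p 1 0 r • w x) (hβ x) (by simp [t_zero])
      (fun i => ?_) r hr
    rw [← ev_smul]
    change Tv k p 1 0 (node β x i) • w x ∈ K
    rw [hw.up]
    rcases hup x hx i with h | h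
    · exact K.smul_mem _ (hmem _ h)
    · rw [h, zero_smul]
      exact K.zero_mem
  have h01 : ∀ r ≤ p, ∀ v ∈ K, t k p 0 1 r • v ∈ K := by
    intro r hr
    refine forall_span_smul_mem hK.symm ?_
    rintro _ ⟨x, hx, rfl⟩
    refine mem_of_ev_nodes_mem (a := fun r => t k p 0 1 r • w x) (hβ x) (by simp [t_zero])
      (fun i => ?_) r hr
    rw [← ev_smul]
    change Tv k p 0 1 (node β x i) • w x ∈ K
    rw [hw.down]
    rcases hdown x hx i with h | h
    · exact K.smul_mem _ (hmem _ h)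
    · rw [h, zero_smul]
      exact K.zero_mem
  have h11 : ∀ r ≤ p, ∀ v ∈ K, t k p 1 1 r • v ∈ K := by
    intro r hr
    refine forall_span_smul_mem hK.symm ?_
    rintro _ ⟨x, hx, rfl⟩
    refine mem_of_ev_mem (a := fun r => t k p 1 1 r • w x) (Set.infinite_univ (α := k))
      (fun u _ => ?_) r hr
    rw [← ev_smul]
    change Tv k p 1 1 u • w x ∈ K
    rw [(hw.hasWeight x).T_smul]
    exact K.smul_mem _ (hmem x hx)
  -- At regular u, T₂₂(u - 1) acts on w x by a nonzero scalar, so the determinant expresses T₁₁(u) •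
  -- w x through w x and T₂₁(u)T₁₂(u-1) • w x.
  have h00 : ∀ r ≤ p, ∀ v ∈ K, t k p 0 0 r • v ∈ K := by
    intro r hr
    refine forall_span_smul_mem hK.symm ?_
    rintro _ ⟨x, hx, rfl⟩
    refine mem_of_ev_mem (a := fun r => t k p 0 0 r • w x) (infinite_regular β)
      (fun u hu => ?_) r hr
    rw [← ev_smul]
    change Tv k p 0 0 u • w x ∈ K
    have h1 := (hw.hasWeight x).D_smul u
    rw [Dv, sub_smul, mul_smul, (hw.hasWeight x).T_smul, smul_smul_comm, sub_eq_iff_eq_add,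
      mul_smul] at h1
    have h2 := eval_poly_shift_ne_zero (regular_sub_one hu) x
    rw [← inv_smul_smul₀ h2 (Tv k p 0 0 u • w x), h1]
    refine K.smul_mem _ (K.add_mem (K.smul_mem _ (hmem x hx)) ?_)
    have h3 : ∀ v ∈ K, Tv k p 1 0 u • v ∈ K := fun v hv => by
      rw [Tv, ev_smul]
      exact ev_mem (fun r hr => h10 r hr v hv) u
    refine h3 _ ?_
    rw [Tv, ev_smul]
    exact ev_mem (fun r hr => h01 r hr _ (hmem x hx)) _
  refine smul_mem_of_t_smul_mem K (fun i j r hr => ?_) y hv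
  fin_cases i <;> fin_cases j
  · exact h00 r hr
  · exact h01 r hr
  · exact h10 r hr
  · exact h11 r hr

/-- The submodule spanned by the weight vectors with weights in a suitable set. -/
def spanSubmodule (hβ : ∀ x, Function.Injective (node β x)) (hw : IsWeightSystem β γ w)
    {Ω : Set (Fin p → ℤ)}
    (hup : ∀ x ∈ Ω, ∀ i, x + Pi.single i 1 ∈ Ω ∨ upCoeff β γ i (x i) = 0)
    (hdown : ∀ x ∈ Ω, ∀ i, x + Pi.single i (-1) ∈ Ω ∨ downCoeff β γ i (x i) = 0) :
    Submodule (Y k p) V where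
  carrier := Submodule.span k (w '' Ω)
  zero_mem' := Submodule.zero_mem _
  add_mem' := fun hv hv' => Submodule.add_mem _ hv hv'
  smul_mem' := fun y _ hv => smul_mem_span hβ hw hup hdown y hv

theorem node_ne_node (hβ : ∀ i j, i ≠ j → ∀ n : ℤ, β i - β j ≠ (n : k)) {x y : Fin p → ℤ}
    {i : Fin p} (h : x i ≠ y i) (j : Fin p) : node β x i ≠ node β y j := by
  intro hn
  simp only [node, neg_inj] at hn
  rcases eq_or_ne i j with rfl | hij
  · exact h (by simpa using hn)
  · refine hβ i j hij (y j - x i) ?_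
    push_cast
    linear_combination hn

theorem exists_eval_ne (hβ : ∀ i j, i ≠ j → ∀ n : ℤ, β i - β j ≠ (n : k)) {x y : Fin p → ℤ}
    (h : x ≠ y) : ∃ u, (poly (shift β x)).eval u ≠ (poly (shift β y)).eval u := by
  obtain ⟨i, hi⟩ := Function.ne_iff.1 h
  refine ⟨node β x i, ?_⟩
  rw [eval_poly_shift, Finset.prod_eq_zero (Finset.mem_univ i) (sub_self _), eval_poly_shift]
  exact (Finset.prod_ne_zero_iff.2 fun j _ => sub_ne_zero.2 (node_ne_node hβ hi j)).symm

/-- The algebra separates finitely many weights. -/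
theorem exists_proj (hβ : ∀ i j, i ≠ j → ∀ n : ℤ, β i - β j ≠ (n : k)) (γ : Fin (2 * p) → k)
    (V : Type*) [AddCommGroup V] [Module k V] [Module (Y k p) V] [IsScalarTower k (Y k p) V]
    (x : Fin p → ℤ) (s : Finset (Fin p → ℤ)) (hs : x ∉ s) :
    ∃ y : Y k p, (∀ v : V, HasWeight β γ x v → y • v = v) ∧
      ∀ z ∈ s, ∀ v : V, HasWeight β γ z v → y • v = 0 := by
  induction s using Finset.induction_on with
  | empty => exact ⟨1, fun v _ => one_smul _ v, by simp⟩
  | insert z s hz ih =>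
    rw [Finset.mem_insert, not_or] at hs
    obtain ⟨y, h1, h2⟩ := ih hs.2
    obtain ⟨u, hu⟩ := exists_eval_ne hβ hs.1
    have key : ∀ z' : Fin p → ℤ, ∀ v : V, HasWeight β γ z' v →
        (y * (Tv k p 1 1 u - algebraMap k _ ((poly (shift β z)).eval u))) • v =
          ((poly (shift β z')).eval u - (poly (shift β z)).eval u) • y • v := by
      intro z' v hv
      rw [mul_smul, sub_smul, hv.T_smul, algebraMap_smul, ← sub_smul, smul_smul_comm]
    -- The new factor T₂₂(u) minus its eigenvalue at weight z kills that weight; the scalar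
    -- normalizes its action on weight x to 1.
    refine ⟨((poly (shift β x)).eval u - (poly (shift β z)).eval u)⁻¹ •
      (y * (Tv k p 1 1 u - algebraMap k _ ((poly (shift β z)).eval u))), ?_, ?_⟩
    · intro v hv
      rw [smul_assoc, key x v hv, h1 v hv, inv_smul_smul₀ (sub_ne_zero.2 hu)]
    · intro z' hz' v hv
      rw [smul_assoc, key z' v hv]
      rcases Finset.mem_insert.1 hz' with rfl | hz'
      · rw [sub_self, zero_smul, smul_zero]
      · rw [h2 z' hz' v hv, smul_zero, smul_zero]

/-- Submodules contain the weight components of their elements. -/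
theorem component_mem (hβ : ∀ i j, i ≠ j → ∀ n : ℤ, β i - β j ≠ (n : k))
    (N : Submodule (Y k p) V) {s : Finset (Fin p → ℤ)} {v : (Fin p → ℤ) → V}
    (hv : ∀ x ∈ s, HasWeight β γ x (v x)) (h : ∑ x ∈ s, v x ∈ N) : ∀ x ∈ s, v x ∈ N := by
  intro x hx
  obtain ⟨y, h1, h2⟩ := exists_proj hβ γ V x (s.erase x) (Finset.notMem_erase x s)
  have := N.smul_mem y h
  rwa [← Finset.add_sum_erase s v hx, smul_add, h1 _ (hv x hx), Finset.smul_sum,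
    Finset.sum_eq_zero fun z hz => h2 z hz _ (hv z (Finset.mem_of_mem_erase hz)), add_zero] at this

theorem component_eq_zero (hβ : ∀ i j, i ≠ j → ∀ n : ℤ, β i - β j ≠ (n : k))
    {s : Finset (Fin p → ℤ)} {v : (Fin p → ℤ) → V}
    (hv : ∀ x ∈ s, HasWeight β γ x (v x)) (h : ∑ x ∈ s, v x = 0) : ∀ x ∈ s, v x = 0 :=
  fun x hx => (Submodule.mem_bot (Y k p)).1
    (component_mem hβ ⊥ hv ((Submodule.mem_bot (Y k p)).2 h) x hx)

end Span

/-! ### Reachable weights -/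

section Box

variable {k : Type*} [Field k] {p : ℕ}

/-- The set of weights that can be left in direction of the weight `0` and reached from it. -/
def reachable (β : Fin p → k) (γ : Fin (2 * p) → k) : Set (Fin p → ℤ) :=
  {x | ∀ i, (∀ m : ℤ, 0 ≤ m → m < x i → (poly γ).eval (-β i - m) ≠ 0) ∧
    ∀ n : ℤ, x i < n → n ≤ 0 → (poly γ).eval (-β i - n + 1) ≠ 0}

variable {β : Fin p → k} {γ : Fin (2 * p) → k}

theorem zero_mem_reachable : (0 : Fin p → ℤ) ∈ reachable β γ := fun i =>
  ⟨fun m h0 h1 => absurd h1 (by simpa using h0), fun n h0 h1 => absurd h1 (by simpa using h0)⟩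

/-- A step from outside into the reachable set goes towards 0, and only a zero of γ at this very
step can have made its starting point unreachable; then the coefficient vanishes. With
`down_notMem_reachable` this makes the span of the unreachable vectors a submodule. -/
theorem up_notMem_reachable (x : Fin p → ℤ) (hx : x ∈ (reachable β γ)ᶜ) (i : Fin p) :
    x + Pi.single i 1 ∈ (reachable β γ)ᶜ ∨ upCoeff β γ i (x i) = 0 := by
  by_contra! h
  obtain ⟨h1, h2⟩ := h
  rw [Set.notMem_compl_iff] at h1
  refine hx fun j => ?_
  rcases eq_or_ne j i with rfl | hj
  · have h3 := h1 j
    rw [Pi.add_apply, Pi.single_eq_same] at h3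
    refine ⟨fun m h4 h5 => h3.1 m h4 (by omega), fun n h4 h5 => ?_⟩
    rcases (show x j + 1 ≤ n by omega).eq_or_lt with rfl | h6
    · rw [upCoeff, if_neg (by omega)] at h2
      convert neg_ne_zero.1 h2 using 2
      push_cast
      ring
    · exact h3.2 n h6 h5
  · have h3 := h1 j
    rwa [Pi.add_apply, Pi.single_eq_of_ne hj, add_zero] at h3

theorem down_notMem_reachable (x : Fin p → ℤ) (hx : x ∈ (reachable β γ)ᶜ) (i : Fin p) :
    x + Pi.single i (-1) ∈ (reachable β γ)ᶜ ∨ downCoeff β γ i (x i) = 0 := by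
  by_contra! h
  obtain ⟨h1, h2⟩ := h
  rw [Set.notMem_compl_iff] at h1
  refine hx fun j => ?_
  rcases eq_or_ne j i with rfl | hj
  · have h3 := h1 j
    rw [Pi.add_apply, Pi.single_eq_same] at h3
    refine ⟨fun m h4 h5 => ?_, fun n h4 h5 => h3.2 n (by omega) h5⟩
    rcases (show m ≤ x j - 1 by omega).eq_or_lt with rfl | h6
    · rw [downCoeff, if_neg (by omega)] at h2
      convert neg_ne_zero.1 h2 using 2
      push_cast
      ring
    · exact h3.1 m h4 (by omega)
  · have h3 := h1 j
    rwa [Pi.add_apply, Pi.single_eq_of_ne hj, add_zero] at h3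

theorem reachable_toward_zero {x : Fin p → ℤ} (hx : x ∈ reachable β γ) (i : Fin p) {s : ℤ}
    (hs : 0 < x i ∧ s = -1 ∨ x i < 0 ∧ s = 1) : x + Pi.single i s ∈ reachable β γ := by
  intro j
  have h := hx j
  rcases eq_or_ne j i with rfl | hj
  · rw [Pi.add_apply, Pi.single_eq_same]
    exact ⟨fun m h1 h2 => h.1 m h1 (by omega), fun n h1 h2 => h.2 n (by omega) h2⟩
  · rwa [Pi.add_apply, Pi.single_eq_of_ne hj, add_zero]

variable {V : Type*} [AddCommGroup V] [Module k V] [Module (Y k p) V]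
  [IsScalarTower k (Y k p) V] [CharZero k] {w : (Fin p → ℤ) → V}

/-- Induction on the sum of the |x i|: reachability says that each step towards 0 has a nonzero,
hence invertible, coefficient. -/
theorem zero_mem_of_mem (hw : IsWeightSystem β γ w) (N : Submodule (Y k p) V) (x : Fin p → ℤ)
    (hx : x ∈ reachable β γ) (h : w x ∈ N) : w 0 ∈ N := by
  induction hn : ∑ i, (x i).natAbs using Nat.strong_induction_on generalizing x with
  | _ n ih =>
  subst hn
  by_cases h0 : x = 0
  · rwa [h0] at h
  obtain ⟨i, hi⟩ := Function.ne_iff.1 h0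
  rw [Pi.zero_apply] at hi
  have hlt : ∀ s : ℤ, (0 < x i ∧ s = -1 ∨ x i < 0 ∧ s = 1) →
      ∑ j, ((x + Pi.single i s : Fin p → ℤ) j).natAbs < ∑ j, (x j).natAbs := by
    intro s hs
    refine Finset.sum_lt_sum (fun j _ => ?_) ⟨i, Finset.mem_univ i, ?_⟩
    · rcases eq_or_ne j i with rfl | hj
      · rw [Pi.add_apply, Pi.single_eq_same]
        omega
      · rw [Pi.add_apply, Pi.single_eq_of_ne hj, add_zero]
    · rw [Pi.add_apply, Pi.single_eq_same]
      omega
  have hinv : ∀ {c : k} {v : V}, c ≠ 0 → c • v ∈ N → v ∈ N := by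
    intro c v hc hv
    rw [← inv_smul_smul₀ hc v, ← algebraMap_smul (Y k p)]
    exact N.smul_mem _ hv
  rcases lt_or_gt_of_ne hi with hneg | hpos
  · refine ih _ (hlt 1 (Or.inr ⟨hneg, rfl⟩)) (x + Pi.single i 1)
      (reachable_toward_zero hx i (Or.inr ⟨hneg, rfl⟩)) ?_ rfl
    have h1 := N.smul_mem (Tv k p 1 0 (node β x i)) h
    rw [hw.up] at h1
    refine hinv ?_ h1
    rw [upCoeff, if_neg (by omega), neg_ne_zero]
    convert (hx i).2 (x i + 1) (by omega) (by omega) using 2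
    push_cast
    ring
  · refine ih _ (hlt (-1) (Or.inl ⟨hpos, rfl⟩)) (x + Pi.single i (-1))
      (reachable_toward_zero hx i (Or.inl ⟨hpos, rfl⟩)) ?_ rfl
    have h1 := N.smul_mem (Tv k p 0 1 (node β x i)) h
    rw [hw.down] at h1
    refine hinv ?_ h1
    rw [downCoeff, if_neg (by omega), neg_ne_zero]
    convert (hx i).1 (x i - 1) (by omega) (by omega) using 2
    push_cast
    ring

end Box

/-! ### Extended integer endpoints -/

section Endpoints

theorem toEInt_injective : Function.Injective toEInt := fun m n h => by
  simpa [toEInt] using h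

theorem toEInt_le_toEInt {m n : ℤ} : toEInt m ≤ toEInt n ↔ m ≤ n := by
  simp [toEInt]

/-- The last clause is the form in which the bound occurs in `reachable`; the first two characterize
the endpoint itself. -/
theorem exists_upper (P : ℤ → Prop) : ∃ a : EInt,
    (∀ m : ℤ, a = toEInt m ↔ IsLeast {m : ℤ | 0 ≤ m ∧ P m} m) ∧
    (a = ⊤ ↔ ∀ m : ℤ, 0 ≤ m → ¬P m) ∧
    ∀ n : ℤ, toEInt n ≤ a ↔ ∀ m : ℤ, 0 ≤ m → m < n → ¬P m := by
  by_cases h : ∃ m : ℤ, 0 ≤ m ∧ P m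
  · obtain ⟨m, hm, hmin⟩ := Int.exists_least_of_bdd ⟨0, fun z (hz : 0 ≤ z ∧ P z) => hz.1⟩ h
    have hleast : IsLeast {m : ℤ | 0 ≤ m ∧ P m} m := ⟨hm, fun z hz => hmin z hz⟩
    refine ⟨toEInt m, fun n => ?_, ?_, fun n => ?_⟩
    · rw [toEInt_injective.eq_iff]
      exact ⟨fun h => h ▸ hleast, fun h => hleast.unique h⟩
    · refine ⟨fun h => absurd h ?_, fun h => absurd hm.2 (h m hm.1)⟩
      simp [toEInt, ← WithBot.coe_top]
    · rw [toEInt_le_toEInt]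
      refine ⟨fun h z hz hzn hP => ?_, fun h => not_lt.1 fun hlt => h m hm.1 hlt hm.2⟩
      exact absurd (hmin z ⟨hz, hP⟩) (by omega)
  · push Not at h
    refine ⟨⊤, fun n => ⟨fun h' => absurd h'.symm ?_, fun h' => absurd h'.1.2 (h n h'.1.1)⟩,
      ⟨fun _ => h, fun _ => rfl⟩, fun n => ⟨fun _ m hm _ => h m hm, fun _ => le_top⟩⟩
    simp [toEInt, ← WithBot.coe_top]

theorem exists_lower (P : ℤ → Prop) : ∃ a : EInt,
    (∀ m : ℤ, a = toEInt m ↔ IsGreatest {m : ℤ | m ≤ 0 ∧ P m} m) ∧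
    (a = ⊥ ↔ ∀ m : ℤ, m ≤ 0 → ¬P m) ∧
    ∀ n : ℤ, a ≤ toEInt n ↔ ∀ m : ℤ, n < m → m ≤ 0 → ¬P m := by
  by_cases h : ∃ m : ℤ, m ≤ 0 ∧ P m
  · obtain ⟨m, hm, hmax⟩ := Int.exists_greatest_of_bdd ⟨0, fun z (hz : z ≤ 0 ∧ P z) => hz.1⟩ h
    have hgreatest : IsGreatest {m : ℤ | m ≤ 0 ∧ P m} m := ⟨hm, fun z hz => hmax z hz⟩
    refine ⟨toEInt m, fun n => ?_, ?_, fun n => ?_⟩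
    · rw [toEInt_injective.eq_iff]
      exact ⟨fun h => h ▸ hgreatest, fun h => hgreatest.unique h⟩
    · refine ⟨fun h => absurd h ?_, fun h => absurd hm.2 (h m hm.1)⟩
      simp [toEInt]
    · rw [toEInt_le_toEInt]
      refine ⟨fun h z hzn hz hP => ?_, fun h => not_lt.1 fun hlt => h m hlt hm.1 hm.2⟩
      exact absurd (hmax z ⟨hz, hP⟩) (by omega)
  · push Not at h
    refine ⟨⊥, fun n => ⟨fun h' => absurd h'.symm ?_, fun h' => absurd h'.1.2 (h n h'.1.1)⟩,
      ⟨fun _ => h, fun _ => rfl⟩, fun n => ⟨fun _ m _ hm => h m hm, fun _ => bot_le⟩⟩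
    simp [toEInt]

end Endpoints

/-! ### Maximal ideals of Γ, generalized weight spaces and supports -/

section Characters

variable {k : Type*} [Field k] [CharZero k] {p : ℕ} {β : Fin p → k} {γ : Fin (2 * p) → k}

theorem shift_generic (hβ : ∀ i j, i ≠ j → ∀ n : ℤ, β i - β j ≠ (n : k)) (x : Fin p → ℤ) :
    ∀ i j, i ≠ j → ∀ n : ℤ, shift β x i - shift β x j ≠ (n : k) := by
  intro i j hij n h
  refine hβ i j hij (n - x i + x j) ?_
  simp only [shift] at h
  push_cast
  linear_combination h

theorem coe_mem_leftIdeal {c : Gam k p} (hc : c ∈ specPoint β γ) :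
    (c : Y k p) ∈ leftIdeal β γ := by
  rw [specPoint] at hc
  induction hc using Submodule.span_induction with
  | mem c hc => exact Submodule.subset_span hc
  | zero => exact Submodule.zero_mem _
  | add c d _ _ hc hd => exact Submodule.add_mem _ hc hd
  | smul a c _ hc => exact Submodule.smul_mem _ (a : Y k p) hc

/-- If 1 lay in this ideal of Γ, it would lie in the left ideal defining M(ℓ). -/
theorem specPoint_ne_top (hp : 0 < p) (hβ : ∀ i j, i ≠ j → ∀ n : ℤ, β i - β j ≠ (n : k)) :
    specPoint β γ ≠ ⊤ := fun h =>
  one_notMem_leftIdeal hp β γ hβ (coe_mem_leftIdeal (c := 1) (h ▸ Submodule.mem_top))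

theorem T_coeff_mem (n : ℕ) : (T k p 1 1).coeff n ∈ Gam k p :=
  Algebra.subset_adjoin (Or.inl ⟨n, rfl⟩)

theorem D_coeff_mem (n : ℕ) : (D k p).coeff n ∈ Gam k p :=
  Algebra.subset_adjoin (Or.inr ⟨n, rfl⟩)

theorem mem_of_coe_eq_sub {J : Ideal (Gam k p)} {c d e : Gam k p} (hc : c ∈ J) (hd : d ∈ J)
    (h : (e : Y k p) = (c : Y k p) - (d : Y k p)) : e ∈ J := by
  have he : e = c + algebraMap k (Gam k p) (-1) * d := by
    refine Subtype.ext (h.trans ?_)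
    rw [Subalgebra.coe_add, Subalgebra.coe_mul, Subalgebra.coe_algebraMap, map_neg, map_one,
      sub_eq_add_neg]
    exact congrArg _ (neg_one_mul (d : Y k p)).symm
  rw [he]
  exact J.add_mem hc (J.mul_mem_left _ hd)

theorem eq_top_of_algebraMap_mem {J : Ideal (Gam k p)} {a : k} (ha : a ≠ 0)
    (h : algebraMap k (Gam k p) a ∈ J) : J = ⊤ := by
  rw [Ideal.eq_top_iff_one]
  have := J.mul_mem_left (algebraMap k _ a⁻¹) h
  rwa [← map_mul, inv_mul_cancel₀ ha, map_one] at this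

theorem exists_mem_specPoint_T (β : Fin p → k) (γ : Fin (2 * p) → k) (n : ℕ) :
    ∃ c ∈ specPoint β γ,
      (c : Y k p) = (T k p 1 1).coeff n - algebraMap k (Y k p) ((poly β).coeff n) := by
  have hmem : (T k p 1 1).coeff n - algebraMap k (Y k p) ((poly β).coeff n) ∈ Gam k p := by
    rw [sub_eq_add_neg, ← map_neg]
    exact (Gam k p).add_mem (T_coeff_mem n) ((Gam k p).algebraMap_mem _)
  refine ⟨⟨_, hmem⟩, Ideal.subset_span (Or.inl ⟨n, ?_⟩), rfl⟩
  rw [coeff_sub, coeff_map]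

theorem exists_mem_specPoint_D (β : Fin p → k) (γ : Fin (2 * p) → k) (n : ℕ) :
    ∃ c ∈ specPoint β γ,
      (c : Y k p) = (D k p).coeff n - algebraMap k (Y k p) ((poly γ).coeff n) := by
  have hmem : (D k p).coeff n - algebraMap k (Y k p) ((poly γ).coeff n) ∈ Gam k p := by
    rw [sub_eq_add_neg, ← map_neg]
    exact (Gam k p).add_mem (D_coeff_mem n) ((Gam k p).algebraMap_mem _)
  refine ⟨⟨_, hmem⟩, Ideal.subset_span (Or.inr ⟨n, ?_⟩), rfl⟩
  rw [coeff_sub, coeff_map]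

/-- Every element of `Γ` is congruent to a scalar modulo `specPoint β γ`. -/
theorem exists_scalar (β : Fin p → k) (γ : Fin (2 * p) → k) {c : Y k p} (hc : c ∈ Gam k p) :
    ∃ a : k, ∃ e ∈ specPoint β γ, (e : Y k p) = c - algebraMap k (Y k p) a := by
  induction hc using Algebra.adjoin_induction with
  | mem c hc =>
    rcases hc with ⟨n, rfl⟩ | ⟨n, rfl⟩
    · exact ⟨_, exists_mem_specPoint_T β γ n⟩
    · exact ⟨_, exists_mem_specPoint_D β γ n⟩
  | algebraMap a => exact ⟨a, 0, Ideal.zero_mem _, (sub_self _).symm⟩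
  | add c d hc hd hc' hd' =>
    obtain ⟨a, e, he, ha⟩ := hc'
    obtain ⟨b, f, hf, hb⟩ := hd'
    refine ⟨a + b, e + f, Ideal.add_mem _ he hf, ?_⟩
    rw [Subalgebra.coe_add, ha, hb, map_add, add_sub_add_comm]
  | mul c d hc hd hc' hd' =>
    obtain ⟨a, e, he, ha⟩ := hc'
    obtain ⟨b, f, hf, hb⟩ := hd'
    -- This is cd - ab = c(d - b) + b(c - a).
    refine ⟨a * b, (⟨c, hc⟩ : Gam k p) * f + algebraMap k (Gam k p) b * e,
      Ideal.add_mem _ (Ideal.mul_mem_left _ _ hf) (Ideal.mul_mem_left _ _ he), ?_⟩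
    rw [Subalgebra.coe_add, Subalgebra.coe_mul, Subalgebra.coe_mul, Subalgebra.coe_algebraMap,
      ha, hb, mul_sub, mul_sub, ← map_mul, mul_comm b a, Algebra.commutes b,
      sub_add_sub_cancel]

theorem exists_scalar_ne_zero {c : Gam k p} (hc : c ∉ specPoint β γ) :
    ∃ a : k, a ≠ 0 ∧ ∃ e ∈ specPoint β γ, (e : Y k p) = (c : Y k p) - algebraMap k (Y k p) a := by
  obtain ⟨a, e, he, ha⟩ := exists_scalar β γ c.2
  refine ⟨a, ?_, e, he, ha⟩
  rintro rfl
  rw [map_zero, sub_zero] at ha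
  exact hc (Subtype.ext ha ▸ he)

theorem specPoint_isMaximal (hp : 0 < p) (hβ : ∀ i j, i ≠ j → ∀ n : ℤ, β i - β j ≠ (n : k)) :
    (specPoint β γ).IsMaximal := by
  refine ⟨⟨specPoint_ne_top hp hβ, fun J hJ => ?_⟩⟩
  obtain ⟨c, hcJ, hc⟩ := SetLike.exists_of_lt hJ
  obtain ⟨a, ha0, e, he, ha⟩ := exists_scalar_ne_zero hc
  refine eq_top_of_algebraMap_mem ha0 (mem_of_coe_eq_sub hcJ (hJ.le he) ?_)
  rw [ha, sub_sub_cancel]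
  rfl

/-- Equal ideals for different x and y would contain the difference of two scalars congruent to the
same coefficient of T₂₂(u), that is, a unit. -/
theorem specPoint_injective (hp : 0 < p) (hβ : ∀ i j, i ≠ j → ∀ n : ℤ, β i - β j ≠ (n : k))
    (γ : Fin (2 * p) → k) :
    Function.Injective fun x : Fin p → ℤ => specPoint (shift β x) γ := by
  intro x y (hxy : specPoint (shift β x) γ = specPoint (shift β y) γ)
  by_contra hne
  obtain ⟨u, hu⟩ := exists_eval_ne hβ hne
  obtain ⟨n, hn⟩ : ∃ n, (poly (shift β x)).coeff n ≠ (poly (shift β y)).coeff n := by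
    by_contra! h
    exact hu (by rw [Polynomial.ext h])
  obtain ⟨c, hc, hcx⟩ := exists_mem_specPoint_T (shift β x) γ n
  obtain ⟨d, hd, hdy⟩ := exists_mem_specPoint_T (shift β y) γ n
  rw [← hxy] at hd
  refine specPoint_ne_top (γ := γ) hp (shift_generic hβ x)
    (eq_top_of_algebraMap_mem (sub_ne_zero.2 hn) (mem_of_coe_eq_sub hd hc ?_))
  rw [hcx, hdy, sub_sub_sub_cancel_left, ← map_sub]
  rfl

variable {V : Type*} [AddCommGroup V] [Module k V] [Module (Y k p) V]
  [IsScalarTower k (Y k p) V]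

theorem HasWeight.smul_eq_zero {x : Fin p → ℤ} {w : V} (h : HasWeight β γ x w) {c : Gam k p}
    (hc : c ∈ specPoint (shift β x) γ) : (c : Y k p) • w = 0 := by
  have hle : leftIdeal (shift β x) γ ≤ LinearMap.ker (LinearMap.toSpanSingleton (Y k p) V w) :=
    Submodule.span_le.2 fun g hg => by simpa using h g hg
  simpa using hle (coe_mem_leftIdeal hc)

theorem HasWeight.mem_genWeightSpace {x : Fin p → ℤ} {w : V} (h : HasWeight β γ x w) :
    w ∈ genWeightSpace V (specPoint (shift β x) γ) :=
  ⟨1, fun c hc => h.smul_eq_zero (by rwa [Submodule.pow_one] at hc)⟩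

variable {w : (Fin p → ℤ) → V}

/-- The generalized weight spaces of a module spanned by weight vectors. -/
theorem exists_of_mem_genWeightSpace (hp : 0 < p)
    (hβ : ∀ i j, i ≠ j → ∀ n : ℤ, β i - β j ≠ (n : k)) (hw : IsWeightSystem β γ w)
    (hspan : Submodule.span k (Set.range w) = ⊤) {m : Ideal (Gam k p)} (hm : m.IsMaximal) {v : V}
    (hv : v ∈ genWeightSpace V m) (hv0 : v ≠ 0) :
    ∃ x, m = specPoint (shift β x) γ ∧ w x ≠ 0 ∧ HasWeight β γ x v := by
  obtain ⟨a, rfl⟩ := Finsupp.mem_span_range_iff_exists_finsupp.1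
    (hspan ▸ Submodule.mem_top : v ∈ Submodule.span k (Set.range w))
  have hwt : ∀ x, HasWeight β γ x (a x • w x) := fun x => (hw.hasWeight x).smul _
  obtain ⟨n, hn⟩ := hv
  have key : ∀ x ∈ a.support, a x • w x ≠ 0 → m = specPoint (shift β x) γ := by
    intro x hx hx0
    -- By maximality an inclusion is enough. An element c of m outside the ideal of x would act on
    -- weight x by a scalar s ≠ 0 and on every other weight by some scalar; then c^n • v = 0 would
    -- force s^n times the x-component of v to vanish.
    refine hm.eq_of_le (specPoint_ne_top hp (shift_generic hβ x)) fun c hc => ?_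
    have hact : ∀ {z : Fin p → ℤ} {s : k} {e : Gam k p}, e ∈ specPoint (shift β z) γ →
        (e : Y k p) = (c : Y k p) - algebraMap k (Y k p) s →
        ∀ v : V, HasWeight β γ z v → (c : Y k p) • v = s • v := by
      intro z s e he hs v hv
      have := hv.smul_eq_zero he
      rwa [hs, sub_smul, sub_eq_zero, algebraMap_smul] at this
    by_contra hcx
    obtain ⟨s, hs0, e, he, hs⟩ := exists_scalar_ne_zero hcx
    choose d f hf hd using fun z => exists_scalar (shift β z) γ c.2
    have hpow : ∀ (e : k) (v : V), (c : Y k p) • v = e • v →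
        ∀ j : ℕ, ((c : Y k p) ^ j) • v = e ^ j • v := by
      intro e v h j
      induction j with
      | zero => simp
      | succ j ih => rw [pow_succ, mul_smul, h, smul_smul_comm, ih, smul_smul, ← pow_succ']
    have h1 := hn (c ^ n) (Ideal.pow_mem_pow hc n)
    rw [Finsupp.sum, Finset.smul_sum, Subalgebra.coe_pow] at h1
    have h2 := component_eq_zero hβ (γ := γ) (v := fun z => ((c : Y k p) ^ n) • a z • w z)
      (fun z _ => by
        rw [hpow (d z) _ (hact (hf z) (hd z) _ (hwt z)) n]
        exact (hwt z).smul _) h1 x hx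
    rw [hpow s _ (hact he hs _ (hwt x)) n] at h2
    exact (smul_ne_zero (pow_ne_zero n hs0) hx0) h2
  obtain ⟨x, hx, hx0⟩ : ∃ x ∈ a.support, a x • w x ≠ 0 := by
    by_contra! h
    exact hv0 (Finset.sum_eq_zero h)
  refine ⟨x, key x hx hx0, fun h => hx0 (by rw [h, smul_zero]), ?_⟩
  rw [Finsupp.sum, ← Finset.add_sum_erase _ _ hx, Finset.sum_eq_zero fun z hz => ?_, add_zero]
  · exact hwt x
  · by_contra hz0
    exact Finset.ne_of_mem_erase hz (specPoint_injective hp hβ γ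
      ((key z (Finset.mem_of_mem_erase hz) hz0).symm.trans (key x hx hx0)))

/-- Nonzero elements of the spaces V(m) are weight vectors, with different weights for different m.
So `exists_proj` isolates each summand of a vanishing sum, and the spanning weight vectors give
surjectivity. -/
theorem isWeight_of_span (hp : 0 < p) (hβ : ∀ i j, i ≠ j → ∀ n : ℤ, β i - β j ≠ (n : k))
    (hw : IsWeightSystem β γ w) (hspan : Submodule.span k (Set.range w) = ⊤)
    (hfin : Module.Finite (Y k p) V) : IsWeight (k := k) (p := p) V := by
  classical
  refine ⟨⟨hfin, ?_, ?_⟩, ?_⟩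
  · rw [injective_iff_map_eq_zero]
    intro f hf
    by_contra hf0
    have hex : ∀ m : Sp k p, ∃ x, f m ≠ 0 →
        m.1 = specPoint (shift β x) γ ∧ HasWeight β γ x (f m : V) := by
      intro m
      by_cases h : f m = 0
      · exact ⟨0, fun h' => absurd h h'⟩
      · obtain ⟨x, h1, -, h2⟩ := exists_of_mem_genWeightSpace hp hβ hw hspan m.2 (f m).2
          (fun h' => h (Subtype.ext h'))
        exact ⟨x, fun _ => ⟨h1, h2⟩⟩
    choose x hx using hex
    have hinj : ∀ m ∈ f.support, ∀ m' ∈ f.support, x m = x m' → m = m' := by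
      intro m hm m' hm' h
      rw [DFinsupp.mem_support_iff] at hm hm'
      exact Subtype.ext (by rw [(hx m hm).1, (hx m' hm').1, h])
    obtain ⟨m, hm⟩ : ∃ m, f m ≠ 0 := by
      by_contra! h
      exact hf0 (DFinsupp.ext h)
    have hms : m ∈ f.support := DFinsupp.mem_support_iff.2 hm
    obtain ⟨y, h1, h2⟩ := exists_proj hβ γ V (x m) ((f.support.erase m).image x) (by
      rw [Finset.mem_image]
      rintro ⟨m', hm', h⟩
      exact Finset.ne_of_mem_erase hm' (hinj _ (Finset.mem_of_mem_erase hm') _ hms h))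
    rw [DirectSum.coeAddMonoidHom_eq_dfinsuppSum, DFinsupp.sum,
      ← Finset.add_sum_erase _ _ hms] at hf
    have h3 := congrArg (y • ·) hf
    simp only [smul_add, smul_zero, Finset.smul_sum] at h3
    rw [h1 _ (hx m hm).2, Finset.sum_eq_zero fun m' hm' => ?_, add_zero] at h3
    · exact hm (Subtype.ext h3)
    · exact h2 _ (Finset.mem_image_of_mem x hm') _
        (hx m' (DFinsupp.mem_support_iff.1 (Finset.mem_of_mem_erase hm'))).2
  · rw [← AddMonoidHom.mrange_eq_top, eq_top_iff]
    rintro v -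
    obtain ⟨a, rfl⟩ := Finsupp.mem_span_range_iff_exists_finsupp.1
      (hspan ▸ Submodule.mem_top : v ∈ Submodule.span k (Set.range w))
    refine sum_mem fun x _ => ?_
    exact ⟨DirectSum.of (fun m : Sp k p => genWeightSpace V m.1)
      ⟨specPoint (shift β x) γ, specPoint_isMaximal hp (shift_generic hβ x)⟩
      ⟨_, ((hw.hasWeight x).smul (a x)).mem_genWeightSpace⟩, DirectSum.coeAddMonoidHom_of _ _ _⟩
  · intro m v hv c hc
    by_cases hv0 : v = 0
    · rw [hv0, smul_zero]
    · obtain ⟨x, h1, -, h2⟩ := exists_of_mem_genWeightSpace hp hβ hw hspan m.2 hv hv0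
      exact h2.smul_eq_zero (h1 ▸ hc)

theorem supp_of_span (hp : 0 < p) (hβ : ∀ i j, i ≠ j → ∀ n : ℤ, β i - β j ≠ (n : k))
    (hw : IsWeightSystem β γ w) (hspan : Submodule.span k (Set.range w) = ⊤) :
    Supp (k := k) (p := p) V = (fun x => specPoint (shift β x) γ) '' {x | w x ≠ 0} := by
  ext m
  constructor
  · rintro ⟨hm, h⟩
    obtain ⟨⟨v, hv⟩, hv0⟩ := AddSubgroup.ne_bot_iff_exists_ne_zero.1 h
    obtain ⟨x, h1, h2, -⟩ := exists_of_mem_genWeightSpace hp hβ hw hspan hm hv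
      fun h => hv0 (Subtype.ext h)
    exact ⟨x, h2, h1.symm⟩
  · rintro ⟨x, hx, rfl⟩
    refine ⟨specPoint_isMaximal hp (shift_generic hβ x), fun h => hx ?_⟩
    have := (hw.hasWeight x).mem_genWeightSpace
    rwa [h, AddSubgroup.mem_bot] at this

end Characters

/-! ### The largest proper submodule of M(ℓ) -/

section Universal

variable {k : Type*} [Field k] [CharZero k] {p : ℕ} {β : Fin p → k} {γ : Fin (2 * p) → k}

theorem IsWeightSystem.map {V W : Type*} [AddCommGroup V] [Module k V] [Module (Y k p) V]
    [IsScalarTower k (Y k p) V] [AddCommGroup W] [Module k W] [Module (Y k p) W]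
    [IsScalarTower k (Y k p) W] {w : (Fin p → ℤ) → V} (hw : IsWeightSystem β γ w)
    (f : V →ₗ[Y k p] W) : IsWeightSystem β γ (fun x => f (w x)) := by
  have hf : ∀ (c : k) (v : V), f (c • v) = c • f v := fun c v => by
    rw [← algebraMap_smul (Y k p) c v, map_smul, algebraMap_smul]
  refine ⟨fun x g hg => ?_, fun x j => ?_, fun x j => ?_⟩
  · rw [← map_smul, hw.hasWeight x g hg, map_zero]
  · rw [← map_smul, hw.up, hf]
  · rw [← map_smul, hw.down, hf]

/-- The module `M(ℓ)` is spanned by weight vectors, and the sum of its proper submodules is spanned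
by those whose weight is not reachable. -/
theorem exists_system_of_universal (hp : 0 < p)
    (hβ : ∀ i j, i ≠ j → ∀ n : ℤ, β i - β j ≠ (n : k)) :
    ∃ w : (Fin p → ℤ) → M β γ, IsWeightSystem β γ w ∧
      Submodule.span k (Set.range w) = ⊤ ∧ IsCoatom (maxSub β γ) ∧
      ∀ x, w x ∈ maxSub β γ ↔ x ∉ reachable β γ := by
  have hβ' := node_injective hβ
  set v₀ : M β γ := Submodule.Quotient.mk 1 with hv₀
  have hv₀w : HasWeight β γ 0 v₀ := by
    intro g hg
    rw [shift_zero] at hg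
    rw [hv₀, ← Submodule.Quotient.mk_smul, smul_eq_mul, mul_one, Submodule.Quotient.mk_eq_zero]
    exact Submodule.subset_span hg
  have hv₀0 : v₀ ≠ 0 := by
    rw [hv₀, Ne, Submodule.Quotient.mk_eq_zero]
    exact one_notMem_leftIdeal hp β γ hβ
  have hgen : ∀ N : Submodule (Y k p) (M β γ), v₀ ∈ N → N = ⊤ := by
    intro N hN
    rw [eq_top_iff]
    rintro v -
    obtain ⟨y, rfl⟩ := Submodule.Quotient.mk_surjective _ v
    have := N.smul_mem y hN
    rwa [hv₀, ← Submodule.Quotient.mk_smul, smul_eq_mul, mul_one] at this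
  obtain ⟨w, hw, hw0⟩ := exists_isWeightSystem hβ' hv₀w
  have hspan : Submodule.span k (Set.range w) = ⊤ := by
    have h := hgen (spanSubmodule hβ' hw (Ω := Set.univ) (fun _ _ _ => Or.inl trivial)
      fun _ _ _ => Or.inl trivial) (Submodule.subset_span ⟨0, trivial, hw0⟩)
    rw [eq_top_iff]
    rintro v -
    rw [← Set.image_univ]
    have : v ∈ (⊤ : Submodule (Y k p) (M β γ)) := trivial
    rwa [← h] at this
  set N₀ := spanSubmodule hβ' hw (Ω := (reachable β γ)ᶜ) up_notMem_reachable
    down_notMem_reachable with hN₀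
  have hN₀mem : ∀ v, v ∈ N₀ ↔ v ∈ Submodule.span k (w '' (reachable β γ)ᶜ) := fun _ => Iff.rfl
  -- A proper N contains the weight components of its elements, and none of these can be a nonzero
  -- multiple of a reachable w x, for then N would contain w 0 and hence be everything.
  have hle : ∀ N : Submodule (Y k p) (M β γ), N ≠ ⊤ → N ≤ N₀ := by
    intro N hN v hv
    obtain ⟨a, rfl⟩ := Finsupp.mem_span_range_iff_exists_finsupp.1
      (hspan ▸ Submodule.mem_top : v ∈ Submodule.span k (Set.range w))
    rw [hN₀mem]
    have hc := component_mem hβ N (fun x _ => (hw.hasWeight x).smul (a x)) hv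
    refine Submodule.sum_mem _ fun x hx => ?_
    by_cases hxr : x ∈ reachable β γ
    · refine absurd (hgen N (hw0 ▸ zero_mem_of_mem hw N x hxr ?_)) hN
      have := N.smul_mem (algebraMap k (Y k p) (a x)⁻¹) (hc x hx)
      rwa [algebraMap_smul, inv_smul_smul₀ (Finsupp.mem_support_iff.1 hx)] at this
    · exact Submodule.smul_mem _ _ (Submodule.subset_span ⟨x, hxr, rfl⟩)
  have h0N₀ : w 0 ∉ N₀ := by
    rw [hN₀mem, Finsupp.mem_span_image_iff_linearCombination]
    rintro ⟨a, ha, h⟩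
    have ha0 : (0 : Fin p → ℤ) ∉ a.support := fun h0 =>
      (Finsupp.mem_supported k a).1 ha h0 zero_mem_reachable
    rw [Finsupp.linearCombination_apply, Finsupp.sum] at h
    -- The equation w 0 = Σ a x • w x is read as a vanishing sum of vectors of distinct weights,
    -- with w 0 as its component of weight 0.
    have h1 := component_eq_zero hβ (γ := γ) (s := insert 0 a.support)
      (v := fun x => if x = 0 then w 0 else -(a x • w x)) (fun x _ => by
        split_ifs with hx
        · rw [hx]
          exact hw.hasWeight 0
        · exact fun g hg => by rw [smul_neg, (hw.hasWeight x).smul (a x) g hg, neg_zero]) (by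
        rw [Finset.sum_insert ha0, if_pos rfl, Finset.sum_congr rfl fun x hx =>
          if_neg (fun h : x = 0 => ha0 (h ▸ hx)), Finset.sum_neg_distrib, h, add_neg_cancel]) 0
      (Finset.mem_insert_self _ _)
    rw [if_pos rfl, hw0] at h1
    exact hv₀0 h1
  have hN₀top : N₀ ≠ ⊤ := fun h => h0N₀ (h ▸ Submodule.mem_top)
  have hmax : maxSub β γ = N₀ := le_antisymm (sSup_le fun N hN => hle N hN) (le_sSup hN₀top)
  refine ⟨w, hw, hspan, ?_, fun x => ?_⟩
  · rw [hmax]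
    refine ⟨hN₀top, fun N hN => ?_⟩
    by_contra h
    exact absurd (hle N h) (not_le_of_gt hN)
  · rw [hmax]
    constructor
    · intro hx hxr
      exact h0N₀ (zero_mem_of_mem hw N₀ x hxr hx)
    · exact fun hx => Submodule.subset_span ⟨x, hx, rfl⟩

end Universal

end Yangian

/-! ### The support of L(ℓ) -/

theorem theorem7 (k : Type*) [Field k] [IsAlgClosed k] [CharZero k] (p : ℕ) (hp : 0 < p)
    (β : Fin p → k) (γ : Fin (2 * p) → k)
    (hβ : ∀ i j, i ≠ j → ∀ n : ℤ, β i - β j ≠ (n : k)) :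
    IsSimpleModule (Yangian.Y k p) (Yangian.L β γ) ∧
    Yangian.IsWeight (k := k) (p := p) (Yangian.L β γ) ∧
    ∃ a a' : Fin p → Yangian.EInt,
      (∀ i, a i ≤ a' i) ∧
      (Function.Injective fun x : Fin p → ℤ => Yangian.specPoint (Yangian.shift β x) γ) ∧
      Yangian.Supp (Yangian.L β γ) =
        (fun x : Fin p → ℤ => Yangian.specPoint (Yangian.shift β x) γ) '' Yangian.box a a' ∧
      (∀ i,
        (∀ m : ℤ, a' i = Yangian.toEInt m ↔
          IsLeast {m : ℤ | 0 ≤ m ∧ (Yangian.poly γ).eval (-β i - (m : k)) = 0} m) ∧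
        (a' i = ⊤ ↔ ∀ m : ℤ, 0 ≤ m → (Yangian.poly γ).eval (-β i - (m : k)) ≠ 0) ∧
        (∀ n : ℤ, a i = Yangian.toEInt n ↔
          IsGreatest {n : ℤ | n ≤ 0 ∧ (Yangian.poly γ).eval (-β i - (n : k) + 1) = 0} n) ∧
        (a i = ⊥ ↔ ∀ n : ℤ, n ≤ 0 → (Yangian.poly γ).eval (-β i - (n : k) + 1) ≠ 0)) := by
  obtain ⟨w, hw, hspan, hco, hmem⟩ := Yangian.exists_system_of_universal (γ := γ) hp hβ
  have hwL := hw.map (Yangian.maxSub β γ).mkQ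
  have hspanL : Submodule.span k (Set.range fun x => (Yangian.maxSub β γ).mkQ (w x)) = ⊤ := by
    rw [eq_top_iff]
    rintro v -
    obtain ⟨v, rfl⟩ := (Yangian.maxSub β γ).mkQ_surjective v
    have hv : v ∈ Submodule.span k (Set.range w) := hspan ▸ Submodule.mem_top
    have := Submodule.mem_map_of_mem
      (f := (Yangian.maxSub β γ).mkQ.restrictScalars k) hv
    rw [Submodule.map_span, ← Set.range_comp] at this
    exact this
  choose a' h1 h2 h3 using fun i =>
    Yangian.exists_upper fun m => (Yangian.poly γ).eval (-β i - (m : k)) = 0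
  choose a h4 h5 h6 using fun i =>
    Yangian.exists_lower fun n => (Yangian.poly γ).eval (-β i - (n : k) + 1) = 0
  refine ⟨isSimpleModule_iff_isCoatom.2 hco, Yangian.isWeight_of_span hp hβ hwL hspanL inferInstance,
    a, a', fun i => ?_, Yangian.specPoint_injective hp hβ γ, ?_,
    fun i => ⟨h1 i, h2 i, h4 i, h5 i⟩⟩
  -- The integer 0 lies between the two endpoints, since the ranges of m to be checked are empty.
  · exact ((h6 i 0).2 fun m hm hm' => absurd hm (not_lt.2 hm')).trans
      ((h3 i 0).2 fun m hm hm' => absurd hm (not_le.2 hm'))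
  · rw [Yangian.supp_of_span hp hβ hwL hspanL]
    congr 1
    ext x
    have hx : (Yangian.maxSub β γ).mkQ (w x) ≠ 0 ↔ x ∈ Yangian.reachable β γ := by
      rw [Ne, Submodule.mkQ_apply, Submodule.Quotient.mk_eq_zero, hmem, not_not]
    refine hx.trans (forall_congr' fun i => ?_)
    rw [h6, h3, and_comm]
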